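/- All manifolds are smooth, Hausdorff, without boundary and finite-dimensional; metrics and connections are smooth. A \emph{statistical manifold} $(M,D,g)$ is a manifold $M$ with a torsion-free connection $D$ and a Riemannian metric $g$ such that $Dg$ is totally symmetric. It has \emph{constant curvature} $c$ if $\Theta_D(X,Y)Z=c\,(g(Y,Z)X-g(X,Z)Y)$ for all vector fields $X,Y,Z$. A \emph{Hessian manifold} is a manifold with a flat torsion-free connection $\nabla$ and a Riemannian metric that is locally of the form $\mathrm{Hess}\,\varphi=\nabla d\varphi$; such a $\varphi$ is called a Hessian potential. A \emph{Hessian cone} over $M$ is a Hessian manifold $(M\times\mathbb R^{>0},\nabla,\ s^2g_M+ds^2)$, with $g_M$ a Riemannian metric on $M$ and $s$ the coordinate on $\mathbb R^{>0}$, such that for some constant $\lambda\neq 0,\tfrac12$ the field $\rho=\lambda s\frac{\partial}{\partial s}$ satisfies $\nabla\rho=\mathrm{Id}$. \textbf{Corollary.} Every statistical manifold $(M,D,g)$ of non-zero constant curvature can be realised as a level set of a Hessian potential on a Hessian cone. Precisely: there are a Hessian cone over $M$, a smooth function $\varphi$ on $M\times\mathbb R^{>0}$ with $\mathrm{Hess}\,\varphi=s^2g_M+ds^2$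 everywhere, a number $t\in\mathbb R$ and a number $s_0>0$ such that (1) $\varphi^{-1}(t)=M\times\{s_0\}$, and $d\varphi(\rho)\neq0$ on this set; (2) under the identification $m\mapsto(m,s_0)$ of $M$ with $\varphi^{-1}(t)$, the metric $s^2g_M+ds^2$ induces $g$; (3) under the same identification $\nabla$ induces $D$ by projection along $\rho$, i.e. $\nabla_XY-D_XY$ is a multiple of $\rho$ for all $X,Y$ tangent to $\varphi^{-1}(t)$. -/

import Mathlib

open scoped Manifold ContDiff Topology

noncomputable section

namespace StatGeom

section General

variable {E : Type*} [NormedAddCommGroup E] [NormedSpace ℝ E]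
  {H : Type*} [TopologicalSpace H] (I : ModelWithCorners ℝ E H)
  (M : Type*) [TopologicalSpace M] [ChartedSpace H M] [IsManifold I ∞ M]

/-- (Not necessarily smooth) vector fields on `M`. -/
abbrev VField : Type _ := (x : M) → TangentSpace I x

/-- Connections on the tangent bundle of `M`; `D Y x v` is `(D_v Y)(x)`.  The axioms (additivity
and Leibniz rule) are those of Mathlib. Smoothness is a separate condition. -/
abbrev Conn : Type _ := CovariantDerivative I E (TangentSpace I : M → Type _)

/-- Smooth Riemannian metrics on `M`. -/
abbrev Metric : Type _ :=
  Bundle.ContMDiffRiemannianMetric I ∞ E (TangentSpace I : M → Type _)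

variable {I M}

/-- The vector field `X` is smooth on some neighbourhood of `x`. -/
def SmoothNear (X : VField I M) (x : M) : Prop :=
  ∀ᶠ y in 𝓝 x, ContMDiffAt I I.tangent ∞ (fun z ↦ (⟨z, X z⟩ : TangentBundle I M)) y

/-- `∇_X Y`. -/
def Conn.along (D : Conn I M) (X Y : VField I M) : VField I M := fun x ↦ D Y x (X x)

/-- The derivative `X f` of the function `f` along `X`. -/
def lieDer (X : VField I M) (f : M → ℝ) : M → ℝ := fun x ↦ mvfderiv I f x (X x)

/-- `Θ(X,Y)Z = ∇_X ∇_Y Z - ∇_Y ∇_X Z - ∇_[X,Y] Z`. -/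
def Conn.curv (D : Conn I M) (X Y Z : VField I M) : VField I M := fun x ↦
  D.along X (D.along Y Z) x - D.along Y (D.along X Z) x
    - D.along (VectorField.mlieBracket I X Y) Z x

/-- `(Hess f)(X,Y) = (∇ df)(X,Y) = X(Y f) - (∇_X Y) f`. -/
def Conn.hess (D : Conn I M) (f : M → ℝ) (X Y : VField I M) : M → ℝ := fun x ↦
  lieDer X (lieDer Y f) x - lieDer (D.along X Y) f x

/-- The function `g(X,Y)`. -/
def Metric.ap (g : Metric I M) (X Y : VField I M) : M → ℝ := fun x ↦ g.inner x (X x) (Y x)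

/-- `(D_X g)(Y,Z) = X(g(Y,Z)) - g(D_X Y, Z) - g(Y, D_X Z)`. -/
def Conn.derMetric (D : Conn I M) (g : Metric I M) (X Y Z : VField I M) : M → ℝ := fun x ↦
  lieDer X (g.ap Y Z) x - g.ap (D.along X Y) Z x - g.ap Y (D.along X Z) x

variable [FiniteDimensional ℝ E]

/-- `D` is a smooth torsion-free connection. -/
structure IsTorsionFreeConn (D : Conn I M) : Prop where
  smooth : CovariantDerivative.ContMDiffCovariantDerivative D ∞
  torsion_free :
    haveI : CompleteSpace E := FiniteDimensional.complete ℝ E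
    D.torsion = 0

/-- `(M, D)` is a flat affine manifold. -/
structure IsFlatAffine (D : Conn I M) : Prop extends IsTorsionFreeConn D where
  flat : ∀ (x : M) (X Y Z : VField I M), SmoothNear X x → SmoothNear Y x → SmoothNear Z x →
    D.curv X Y Z x = 0

/-- `f` is a Hessian potential of `g` on the open set `U`: it is smooth there and
`g = Hess f` on `U`. -/
structure IsHessianPotentialOn (D : Conn I M) (g : Metric I M) (U : Set M) (f : M → ℝ) :
    Prop where
  smooth : ContMDiffOn I 𝓘(ℝ, ℝ) ∞ f U
  metric_eq : ∀ x ∈ U, ∀ X Y : VField I M, SmoothNear X x → SmoothNear Y x →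
    g.ap X Y x = D.hess f X Y x

/-- `(M, D, g)` is a Hessian manifold: `D` is flat and torsion-free, and `g` is locally the
Hessian of a function. -/
structure IsHessian (D : Conn I M) (g : Metric I M) : Prop extends IsFlatAffine D where
  locally_hessian : ∀ x : M, ∃ U : Set M, IsOpen U ∧ x ∈ U ∧
    ∃ f : M → ℝ, IsHessianPotentialOn D g U f

/-- `(M, D, r)` is a radiant manifold: `(M, D)` is flat affine and `∇ r = Id`. -/
structure IsRadiant (D : Conn I M) (r : VField I M) : Prop extends IsFlatAffine D where
  smooth_field : ContMDiff I I.tangent ∞ (fun z ↦ (⟨z, r z⟩ : TangentBundle I M))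
  der_eq_id : ∀ (x : M) (v : TangentSpace I x), D r x v = v

/-- `(M, D, g)` is a statistical manifold: `D` is torsion-free and `D g` is totally symmetric. -/
structure IsStatistical (D : Conn I M) (g : Metric I M) : Prop extends IsTorsionFreeConn D where
  symm_left : ∀ (x : M) (X Y Z : VField I M),
    SmoothNear X x → SmoothNear Y x → SmoothNear Z x →
    D.derMetric g X Y Z x = D.derMetric g Y X Z x
  symm_right : ∀ (x : M) (X Y Z : VField I M),
    SmoothNear X x → SmoothNear Y x → SmoothNear Z x →
    D.derMetric g X Y Z x = D.derMetric g X Z Y x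

/-- `Θ_D(X,Y)Z = c (g(Y,Z) X - g(X,Z) Y)`. -/
def HasConstCurv (D : Conn I M) (g : Metric I M) (c : ℝ) : Prop :=
  ∀ (x : M) (X Y Z : VField I M), SmoothNear X x → SmoothNear Y x → SmoothNear Z x →
    D.curv X Y Z x = c • (g.ap Y Z x • X x - g.ap X Z x • Y x)

end General

/-- The positive half-line `ℝ^{>0}`, as an open subset (hence an open submanifold) of `ℝ`. -/
def PosReal : TopologicalSpace.Opens ℝ := ⟨Set.Ioi 0, isOpen_Ioi⟩

section Cone

variable (E : Type*) [NormedAddCommGroup E] [NormedSpace ℝ E]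

/-- The model of `M × ℝ^{>0}`, for `M` modelled on `E`. -/
abbrev coneModel : ModelWithCorners ℝ (E × ℝ) (ModelProd E ℝ) := 𝓘(ℝ, E).prod 𝓘(ℝ, ℝ)

variable {E} {M : Type*} [TopologicalSpace M] [ChartedSpace E M]

/-- The tangent vector `v + a ∂/∂s` at `p = (m, s)`, in `T_p (M × ℝ^{>0}) = T_m M × T_s ℝ^{>0}`. -/
def tvec (p : M × PosReal) (v : TangentSpace 𝓘(ℝ, E) p.1) (a : ℝ) :
    TangentSpace (coneModel E) p := ((v, a) : E × ℝ)

/-- The vector field `l s ∂/∂s` on `M × ℝ^{>0}`. -/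
def radial (l : ℝ) : VField (coneModel E) (M × PosReal) := fun p ↦ tvec p 0 (l * (p.2 : ℝ))

variable (E M) [FiniteDimensional ℝ E] [IsManifold 𝓘(ℝ, E) ∞ M]

/-- Hessian cones `(M × ℝ^{>0}, ∇, s² g_M + ds²)`, together with the constant `l ≠ 0, 1/2` such
that `l s ∂/∂s` is a radiant vector field. -/
structure HessianCone where
  /-- the metric `g_M` -/
  base : Metric 𝓘(ℝ, E) M
  /-- the connection `∇` on `M × ℝ^{>0}` -/
  conn : Conn (coneModel E) (M × PosReal)
  /-- the metric on `M × ℝ^{>0}` -/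
  metric : Metric (coneModel E) (M × PosReal)
  metric_eq : ∀ (p : M × PosReal) (v w : TangentSpace 𝓘(ℝ, E) p.1) (a b : ℝ),
    metric.inner p (tvec p v a) (tvec p w b) = (p.2 : ℝ) ^ 2 * base.inner p.1 v w + a * b
  isHessian : IsHessian conn metric
  /-- the constant usually called `λ` -/
  l : ℝ
  l_ne_zero : l ≠ 0
  l_ne_half : l ≠ 1 / 2
  isRadiant : IsRadiant conn (radial l)

variable {E M}

/-- The statistical manifold `(M, D, g)` is the level set `f = t` in the Hessian cone `C`, through
the embedding `m ↦ (m, s₀)`: this embedding identifies `M` with the level set, the radiant vector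
field is transverse to the level set, the metric of `C` induces `g` on it, and the connection of
`C` induces `D` on it by projection along the radiant vector field. -/
structure HessianCone.IsLevel (C : HessianCone E M) (f : M × PosReal → ℝ) (t : ℝ) (s₀ : PosReal)
    (D : Conn 𝓘(ℝ, E) M) (g : Metric 𝓘(ℝ, E) M) : Prop where
  range_eq : Set.range (fun m : M ↦ (m, s₀)) = f ⁻¹' {t}
  transverse : ∀ m : M, lieDer (radial (E := E) C.l) f (m, s₀) ≠ 0
  induced_metric : ∀ (m : M) (v w : TangentSpace 𝓘(ℝ, E) m),
    C.metric.inner (m, s₀) (tvec (m, s₀) v 0) (tvec (m, s₀) w 0) = g.inner m v w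
  /- If the vector field `Z` on the cone restricts on the level set to the vector field `Y`
  tangent to it, then `∇_v Z - D_v Y` is a multiple of the radiant vector. -/
  induced_conn : ∀ (m : M) (Y : VField 𝓘(ℝ, E) M) (Z : VField (coneModel E) (M × PosReal)),
    SmoothNear Y m → SmoothNear Z (m, s₀) →
    (∀ᶠ x in 𝓝 m, Z (x, s₀) = tvec (x, s₀) (Y x) 0) →
    ∀ v : TangentSpace 𝓘(ℝ, E) m, ∃ b : ℝ,
      C.conn Z (m, s₀) (tvec (m, s₀) v 0)
        = tvec (m, s₀) (D Y m v) 0 + b • radial (E := E) C.l (m, s₀)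

end Cone

end StatGeom

end

noncomputable section

set_option linter.unusedSectionVars false

namespace StatGeom

/-! ### Locally smooth functions and fields, tensoriality, and the curvature tensor. -/

section General
open Bundle Filter VectorField

variable {E : Type*} [NormedAddCommGroup E] [NormedSpace ℝ E]
  {H : Type*} [TopologicalSpace H] {I : ModelWithCorners ℝ E H}
  {M : Type*} [TopologicalSpace M] [ChartedSpace H M] [IsManifold I ∞ M]

/-! Put ρ = λ s ∂/∂s on M × ℝ^{>0} and extend D to the connection ∇ with ∇_X Y = D_X Y - c g(X,Y) ρ,
∇_ρ X = X and ∇ρ = Id, for X, Y lifted from M. It is torsion-free because D is and g is symmetric.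
Its curvature on lifted fields has M-component Θ_D(X,Y)Z - c (g(Y,Z) X - g(X,Z) Y) and ρ-component
-c ((D_X g)(Y,Z) - (D_Y g)(X,Z)). The first vanishes by constant curvature, the second by symmetry
of Dg (`coneConn_flat`).

For this ∇ the Hessian of a s² is 2a ((2 - λ⁻¹) ds² + c λ s² g) (`hess_squarePotential`), with a and
λ still free. Imposing 2a (2 - λ⁻¹) = 1 and k = 2acλ > 0, possible since c ≠ 0
(`exists_cone_constants`), turns it into the cone metric s² (k g) + ds². The level sets of a s² are
the slices of constant s. The slice s₀ = 1/√k carries the metric s₀² k g = g, and projecting ∇ along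
ρ returns D by construction (`isLevel_hessianConeOf`).

The labour lies in defining ∇ on arbitrary fields (`coneConnFun`) while computing only on fields X +
fρ with X and f from M (`along_coneField`). Every tangent vector is the value of such a field with f
constant (`coneField_eq_self`), so torsion and curvature, being tensors, can be tested there
(`Conn.curv_congr`). Smoothness of ∇ follows because every field is locally a combination of lifted
fields and ρ, with coefficients that are functions on the cone (`exists_smoothNear_decomposition`).
-/

variable (I) in
/-- The function `f` is smooth on some neighbourhood of `x`. -/
def SmoothFunNear (f : M → ℝ) (x : M) : Prop := ∀ᶠ y in 𝓝 x, ContMDiffAt I 𝓘(ℝ, ℝ) ∞ f y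

namespace SmoothFunNear

variable {f f' : M → ℝ} {x : M}

lemma contMDiffAt (h : SmoothFunNear I f x) : ContMDiffAt I 𝓘(ℝ, ℝ) ∞ f x := h.self_of_nhds

lemma mdifferentiableAt (h : SmoothFunNear I f x) : MDifferentiableAt I 𝓘(ℝ, ℝ) f x :=
  h.contMDiffAt.mdifferentiableAt (by simp)

lemma eventually (h : SmoothFunNear I f x) : ∀ᶠ y in 𝓝 x, SmoothFunNear I f y :=
  eventually_eventually_nhds.2 h

lemma const (a : ℝ) : SmoothFunNear I (fun _ : M ↦ a) x :=
  Eventually.of_forall fun _ ↦ contMDiffAt_const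

lemma congr (h : SmoothFunNear I f x) (h' : f' =ᶠ[𝓝 x] f) : SmoothFunNear I f' x := by
  filter_upwards [h, h'.eventuallyEq_nhds] with y hy hy' using hy.congr_of_eventuallyEq hy'

end SmoothFunNear

namespace SmoothNear

variable {X Y : VField I M} {x : M}

lemma contMDiffAt (h : SmoothNear X x) :
    ContMDiffAt I I.tangent ∞ (fun z ↦ (⟨z, X z⟩ : TangentBundle I M)) x := h.self_of_nhds

lemma mdifferentiableAt (h : SmoothNear X x) :
    MDifferentiableAt I I.tangent (fun z ↦ (⟨z, X z⟩ : TangentBundle I M)) x :=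
  h.contMDiffAt.mdifferentiableAt (by simp)

lemma eventually (h : SmoothNear X x) : ∀ᶠ y in 𝓝 x, SmoothNear X y :=
  eventually_eventually_nhds.2 h

lemma congr (h : SmoothNear X x) (h' : ∀ᶠ y in 𝓝 x, Y y = X y) : SmoothNear Y x := by
  filter_upwards [h, eventually_eventually_nhds.2 h'] with y hy hy'
  refine hy.congr_of_eventuallyEq ?_
  filter_upwards [hy'] with z hz
  rw [hz]

lemma add (hX : SmoothNear X x) (hY : SmoothNear Y x) : SmoothNear (X + Y) x := by
  filter_upwards [hX, hY] with y h h' using h.add_section h'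

lemma smul {f : M → ℝ} (hf : SmoothFunNear I f x) (hY : SmoothNear Y x) :
    SmoothNear (f • Y) x := by
  filter_upwards [hf, hY] with y h h' using h.smul_section h'

lemma const_smul (a : ℝ) (hY : SmoothNear Y x) : SmoothNear (a • Y) x :=
  smul (.const a) hY

lemma sum {ι : Type*} {s : Finset ι} {Z : ι → VField I M} (h : ∀ i ∈ s, SmoothNear (Z i) x) :
    SmoothNear (fun y ↦ ∑ i ∈ s, Z i y) x := by
  have : ∀ᶠ y in 𝓝 x, ∀ i ∈ s, ContMDiffAt I I.tangent ∞
      (fun z ↦ (⟨z, Z i z⟩ : TangentBundle I M)) y :=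
    (Filter.eventually_all_finset s).2 h
  filter_upwards [this] with y hy using .sum_section hy

/-- A vector field which is smooth near a point agrees near that point with a globally smooth
vector field. -/
lemma exists_contMDiff [FiniteDimensional ℝ E] [T2Space M] (h : SmoothNear X x) :
    ∃ X' : VField I M, ContMDiff I I.tangent ∞ (fun z ↦ (⟨z, X' z⟩ : TangentBundle I M)) ∧
      ∀ᶠ y in 𝓝 x, X' y = X y := by
  obtain ⟨U, hU, hUo, hxU⟩ := eventually_nhds_iff.1 h
  obtain ⟨ψ, -, hψ⟩ := (SmoothBumpFunction.nhds_basis_tsupport (I := I) x).mem_iff.1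
    (hUo.mem_nhds hxU)
  refine ⟨(ψ : M → ℝ) • X, ?_, ?_⟩
  · exact ContMDiffOn.smul_section_of_tsupport ψ.contMDiff.contMDiffOn hUo hψ
      fun y hy ↦ (hU y hy).contMDiffWithinAt
  · filter_upwards [ψ.eventuallyEq_one] with y hy
    simp [hy]

lemma mlieBracket [CompleteSpace E] (hX : SmoothNear X x) (hY : SmoothNear Y x) :
    SmoothNear (mlieBracket I X Y) x := by
  have : IsManifold I (minSmoothness ℝ 2) M := by
    rw [minSmoothness_of_isRCLikeNormedField]; infer_instance
  have : IsManifold I ((⊤ : ℕ∞) + 1) M := ‹IsManifold I ∞ M›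
  filter_upwards [hX, hY] with y h h'
  refine ContMDiffAt.mlieBracket_vectorField (n := ⊤) (m := ⊤) h h' ?_
  simp

end SmoothNear

lemma SmoothFunNear.lieDer {X : VField I M} {f : M → ℝ} {x : M} (hX : SmoothNear X x)
    (hf : SmoothFunNear I f x) : SmoothFunNear I (lieDer X f) x := by
  filter_upwards [hX, hf] with y h h'
  have h1 := h'.mfderiv_const (m := ∞) (by simp)
  have h2 : ContMDiffAt I (𝓘(ℝ, ℝ)).tangent ∞
      (fun m ↦ (⟨f m, mfderiv I 𝓘(ℝ, ℝ) f m (X m)⟩ : TangentBundle 𝓘(ℝ, ℝ) ℝ)) y :=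
    ContMDiffAt.clm_apply_of_inCoordinates (b₁ := id) (b₂ := f) h1 h h'
  exact (contMDiff_snd_tangentBundle_modelSpace ℝ 𝓘(ℝ, ℝ)).contMDiffAt.comp y h2

lemma smoothNear_extend {x : M} (v : TangentSpace I x) :
    SmoothNear (FiberBundle.extend E v : VField I M) x := by
  obtain ⟨s, hs, h⟩ := FiberBundle.exists_contMDiffOn_extend (k := ∞) I E v
  filter_upwards [eventually_mem_nhds_iff.2 hs] with y hy using h.contMDiffAt hy

section HomBundle

variable {F : Type*} [NormedAddCommGroup F] [NormedSpace ℝ F]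
  {V : M → Type*} [TopologicalSpace (TotalSpace F V)]
  [∀ x, AddCommGroup (V x)] [∀ x, Module ℝ (V x)] [∀ x, TopologicalSpace (V x)]
  [∀ x, IsTopologicalAddGroup (V x)] [∀ x, ContinuousSMul ℝ (V x)]
  [FiberBundle F V] [VectorBundle ℝ F V]

/-- In finite dimension φ is the finite sum of the tensors bᵢ* ⊗ φ(bᵢ) over a basis b. -/
lemma _root_.ContMDiffAt.clm_of_forall_apply {N : Type*} [TopologicalSpace N] [ChartedSpace H N]
    [FiniteDimensional ℝ E] {n : ℕ∞ω} {φ : N → E →L[ℝ] F} {x : N}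
    (h : ∀ v, ContMDiffAt I 𝓘(ℝ, F) n (fun y ↦ φ y v) x) :
    ContMDiffAt I 𝓘(ℝ, E →L[ℝ] F) n φ x := by
  let b := Module.finBasis ℝ E
  have key : φ = fun y ↦ ∑ i, ContinuousLinearMap.smulRightL ℝ E F
      (LinearMap.toContinuousLinearMap (b.coord i)) (φ y (b i)) := by
    ext y v
    conv_lhs => rw [← b.sum_repr v, map_sum]
    simp [sum_apply]
  rw [key]
  exact contMDiffAt_finsetSum fun i _ ↦
    (ContinuousLinearMap.contMDiff _).contMDiffAt.comp x (h (b i))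

/-- A section of the bundle of homomorphisms from the tangent bundle to `V` is smooth if it maps
smooth vector fields to smooth sections. -/
lemma contMDiffAt_hom_of_forall_apply [FiniteDimensional ℝ E]
    {n : ℕ∞ω} {φ : ∀ y, TangentSpace I y →L[ℝ] V y} {x : M}
    (h : ∀ σ : VField I M, SmoothNear σ x →
      ContMDiffAt I (I.prod 𝓘(ℝ, F)) n (fun y ↦ TotalSpace.mk' F y (φ y (σ y))) x) :
    ContMDiffAt I (I.prod 𝓘(ℝ, E →L[ℝ] F)) n
      (fun y ↦ TotalSpace.mk' (E →L[ℝ] F) (E := fun y ↦ TangentSpace I y →L[ℝ] V y) y (φ y)) x := by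
  rw [contMDiffAt_hom_bundle]
  refine ⟨contMDiffAt_id, ContMDiffAt.clm_of_forall_apply fun v ↦ ?_⟩
  have hx := FiberBundle.mem_baseSet_trivializationAt' (F := E) (E := (TangentSpace I : M → _)) x
  have hx' := FiberBundle.mem_baseSet_trivializationAt' (F := F) (E := V) x
  -- The test field has constant coordinates v in the trivialization at x, so its image in
  -- coordinates is the matrix of φ applied to v.
  have := (contMDiffAt_section x).1
    (h _ (smoothNear_extend ((trivializationAt E (TangentSpace I) x).symm x v)))
  refine this.congr_of_eventuallyEq ?_
  filter_upwards [(trivializationAt E (TangentSpace I) x).open_baseSet.mem_nhds hx,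
    (trivializationAt F V x).open_baseSet.mem_nhds hx'] with y hy hy'
  rw [ContinuousLinearMap.inCoordinates_eq hy hy']
  simp [FiberBundle.extend, Trivialization.apply_mk_symm _ hx]

end HomBundle

section Tensorial

variable [FiniteDimensional ℝ E] {A : Type*} [AddCommGroup A] [Module ℝ A]
  {Φ : VField I M → A} {x : M}

/-- An operation on vector fields which is linear over the functions that are smooth near `x`
depends only on the value of the vector field at `x`. -/
lemma eq_of_tensorial
    (hadd : ∀ X Y, SmoothNear X x → SmoothNear Y x → Φ (X + Y) = Φ X + Φ Y)
    (hsmul : ∀ (f : M → ℝ) X, SmoothFunNear I f x → SmoothNear X x → Φ (f • X) = f x • Φ X)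
    {X Y : VField I M} (hX : SmoothNear X x) (hY : SmoothNear Y x) (hXY : X x = Y x) :
    Φ X = Φ Y := by
  classical
  have hloc : ∀ {σ σ' : VField I M}, SmoothNear σ x → SmoothNear σ' x →
      (∀ᶠ y in 𝓝 x, σ y = σ' y) → Φ σ = Φ σ' := by
    intro σ σ' hσ hσ' h
    -- The indicator of the agreement set serves as cutoff: it is 1 near x, and smoothness is only
    -- demanded near x, so no bump function is needed.
    let ψ (y : M) : ℝ := if σ y = σ' y then 1 else 0
    have hψx : ψ x = 1 := by simp [ψ, h.self_of_nhds]
    have H : ψ • σ = ψ • σ' := by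
      ext1 y
      by_cases hy : σ y = σ' y <;> simp [ψ, hy]
    have hψ : SmoothFunNear I ψ x :=
      (SmoothFunNear.const 1).congr (h.mono fun y hy ↦ by simp [ψ, hy])
    calc Φ σ = Φ (ψ • σ) := by simp [hsmul _ _ hψ hσ, hψx]
      _ = Φ σ' := by rw [H]; simp [hsmul _ _ hψ hσ', hψx]
  have hsum : ∀ {ι : Type _} (s : Finset ι) (Z : ι → VField I M), (∀ i ∈ s, SmoothNear (Z i) x) →
      Φ (fun y ↦ ∑ i ∈ s, Z i y) = ∑ i ∈ s, Φ (Z i) := by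
    intro ι s Z hZ
    induction s using Finset.induction_on with
    | empty =>
      have h0 : SmoothNear (0 : VField I M) x :=
        Eventually.of_forall fun y ↦ (contMDiff_zeroSection ℝ (TangentSpace I : M → _)) y
      simpa using! hsmul (fun _ ↦ 0) 0 (.const 0) h0
    | insert a s ha ih =>
      simp only [Finset.mem_insert, forall_eq_or_imp] at hZ
      rw [Finset.sum_insert ha, ← ih hZ.2, ← hadd _ _ hZ.1 (.sum hZ.2)]
      simp only [Finset.sum_insert ha]
      rfl
  let t := trivializationAt E (TangentSpace I : M → Type _) x
  have hx : x ∈ t.baseSet := FiberBundle.mem_baseSet_trivializationAt' x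
  let b := Module.finBasis ℝ E
  have hfr (i) : SmoothNear (t.localFrame b i) x := by
    filter_upwards [t.open_baseSet.mem_nhds hx] with y hy using
      contMDiffAt_localFrame_of_mem ∞ _ b i hy
  have hc {σ : VField I M} (hσ : SmoothNear σ x) (i) :
      SmoothFunNear I (LinearMap.piApply (t.localFrameCoeff I b i) σ) x := by
    filter_upwards [hσ, t.open_baseSet.mem_nhds hx] with y hy hy'
    exact contMDiffAt_localFrameCoeff b hy' hy i
  have hexp {σ : VField I M} (hσ : SmoothNear σ x) :
      Φ σ = ∑ i, t.localFrameCoeff I b i x (σ x) • Φ (t.localFrame b i) := by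
    have h1 : ∀ i, SmoothNear (LinearMap.piApply (t.localFrameCoeff I b i) σ • t.localFrame b i) x :=
      fun i ↦ (hfr i).smul (hc hσ i)
    rw [hloc hσ (.sum (s := Finset.univ) fun i _ ↦ h1 i)
      (t.eventually_eq_localFrame_sum_coeff_smul b hx), hsum _ _ fun i _ ↦ h1 i]
    refine Finset.sum_congr rfl fun i _ ↦ ?_
    rw [hsmul _ _ (hc hσ i) (hfr i)]
    rfl
  rw [hexp hX, hexp hY, hXY]

end Tensorial

section Curvature

variable [FiniteDimensional ℝ E]

/-- Apply the Jacobi identity to X, Y, fZ, subtract f times the one for X, Y, Z, and compare the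
coefficients of Z. This needs Z(x) ≠ 0, hence a nontrivial model space; the model E × ℝ of the cone
always is. -/
lemma lieDer_mlieBracket [Nontrivial E] {X Y : VField I M} {f : M → ℝ} {x : M}
    (hX : SmoothNear X x) (hY : SmoothNear Y x) (hf : SmoothFunNear I f x) :
    lieDer (mlieBracket I X Y) f x = lieDer X (lieDer Y f) x - lieDer Y (lieDer X f) x := by
  have : CompleteSpace E := FiniteDimensional.complete ℝ E
  have : IsManifold I (minSmoothness ℝ 3) M := by
    rw [minSmoothness_of_isRCLikeNormedField]; infer_instance
  have : IsManifold I 2 M := inferInstance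
  obtain ⟨v, hv⟩ : ∃ v : TangentSpace I x, v ≠ 0 := exists_ne (0 : E)
  obtain ⟨Z, hZ, hZv⟩ : ∃ Z : VField I M, SmoothNear Z x ∧ Z x = v :=
    ⟨_, smoothNear_extend v, FiberBundle.extend_apply_self E v⟩
  have hcm {W : VField I M} (hW : SmoothNear W x) := hW.contMDiffAt.of_le
    (show minSmoothness ℝ 2 ≤ ∞ by
      rw [minSmoothness_of_isRCLikeNormedField]; exact ENat.LEInfty.out)
  have J1 := leibniz_identity_mlieBracket_apply (hcm hX) (hcm hY) (hcm (hZ.smul hf))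
  have J2 := leibniz_identity_mlieBracket_apply (hcm hX) (hcm hY) (hcm hZ)
  have e1 (W : VField I M) (hW : SmoothNear W x) :
      ∀ᶠ y in 𝓝 x, mlieBracket I W (f • Z) y = (lieDer W f • Z + f • mlieBracket I W Z) y := by
    filter_upwards [hf.eventually, hZ.eventually] with y h1 h2
    exact mlieBracket_smul_right h1.mdifferentiableAt h2.mdifferentiableAt
  have e2 (W W' : VField I M) (hW : SmoothNear W x) (hW' : SmoothNear W' x) :
      mlieBracket I W (mlieBracket I W' (f • Z)) x = lieDer W (lieDer W' f) x • Z x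
        + lieDer W' f x • mlieBracket I W Z x + lieDer W f x • mlieBracket I W' Z x
        + f x • mlieBracket I W (mlieBracket I W' Z) x := by
    rw [EventuallyEq.mlieBracket_vectorField_eq (.refl _ W) (e1 W' hW'),
      mlieBracket_add_right (hZ.smul (hf.lieDer hW')).mdifferentiableAt
        ((hW'.mlieBracket hZ).smul hf).mdifferentiableAt,
      mlieBracket_smul_right (hf.lieDer hW').mdifferentiableAt hZ.mdifferentiableAt,
      mlieBracket_smul_right hf.mdifferentiableAt (hW'.mlieBracket hZ).mdifferentiableAt]
    simp only [lieDer]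
    abel
  rw [e2 X Y hX hY, e2 Y X hY hX, mlieBracket_smul_right hf.mdifferentiableAt hZ.mdifferentiableAt,
    J2] at J1
  have : (lieDer (mlieBracket I X Y) f x - (lieDer X (lieDer Y f) x - lieDer Y (lieDer X f) x)) • Z x
      = 0 := by
    simp only [lieDer] at J1 ⊢
    rw [← sub_eq_zero] at J1
    rw [← neg_eq_zero, ← J1]
    module
  rw [hZv] at this
  exact sub_eq_zero.1 ((smul_eq_zero.1 this).resolve_right hv)

variable [T2Space M] {D : Conn I M} {X Y Z X' Z' : VField I M} {x : M}

lemma Conn.congr (D : Conn I M) (hY : SmoothNear Y x) (h : ∀ᶠ y in 𝓝 x, Z y = Y y) :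
    D Z x = D Y x :=
  D.isCovariantDerivativeOnUniv.congr_of_eventuallyEq (hY.congr h).mdifferentiableAt
    hY.mdifferentiableAt univ_mem h

/-- Smoothness of a connection is a statement about globally smooth fields, so the field is first
replaced by a global one with the same germ. -/
lemma Conn.eventually_contMDiffAt (hD : CovariantDerivative.ContMDiffCovariantDerivative D ∞)
    (hY : SmoothNear Y x) : ∀ᶠ y in 𝓝 x, ContMDiffAt I (I.prod 𝓘(ℝ, E →L[ℝ] E)) ∞
      (fun z ↦ TotalSpace.mk' (E →L[ℝ] E)
        (E := fun z ↦ TangentSpace I z →L[ℝ] TangentSpace I z) z (D Y z)) y := by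
  obtain ⟨Y', hY', h⟩ := hY.exists_contMDiff
  have := hD.contMDiff.contMDiff (σ := Y') (by simpa using hY'.contMDiffOn)
  filter_upwards [eventually_eventually_nhds.2 h] with y hy
  refine (this.contMDiffAt univ_mem).congr_of_eventuallyEq ?_
  filter_upwards [eventually_eventually_nhds.2 hy] with z hz
  rw [D.congr (.of_forall hY') (hz.mono fun _ h ↦ h.symm)]

lemma SmoothNear.along (hD : CovariantDerivative.ContMDiffCovariantDerivative D ∞)
    (hX : SmoothNear X x) (hY : SmoothNear Y x) : SmoothNear (D.along X Y) x := by
  filter_upwards [hX, D.eventually_contMDiffAt hD hY] with y h h' using h'.clm_bundle_apply h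

lemma Conn.along_add_left (D : Conn I M) (X X' Y : VField I M) :
    D.along (X + X') Y = D.along X Y + D.along X' Y := by
  ext1 y; simp [Conn.along]

lemma Conn.along_smul_left (D : Conn I M) (f : M → ℝ) (X Y : VField I M) :
    D.along (f • X) Y = f • D.along X Y := by
  ext1 y; simp [Conn.along]

lemma Conn.along_add_right (D : Conn I M) (X : VField I M) (hY : SmoothNear Y x)
    (hZ : SmoothNear Z x) : D.along X (Y + Z) x = D.along X Y x + D.along X Z x := by
  simp [Conn.along, D.isCovariantDerivativeOnUniv.add hY.mdifferentiableAt hZ.mdifferentiableAt]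

lemma Conn.along_smul_right (D : Conn I M) (X : VField I M) {f : M → ℝ}
    (hf : SmoothFunNear I f x) (hY : SmoothNear Y x) :
    D.along X (f • Y) x = f x • D.along X Y x + lieDer X f x • Y x := by
  simp [Conn.along, lieDer,
    D.isCovariantDerivativeOnUniv.leibniz hY.mdifferentiableAt hf.mdifferentiableAt]

lemma Conn.along_congr (D : Conn I M) (X : VField I M) (hY : SmoothNear Y x)
    (h : ∀ᶠ y in 𝓝 x, Z y = Y y) : D.along X Z x = D.along X Y x := by
  simp [Conn.along, D.congr hY h]

lemma Conn.curv_swap (D : Conn I M) (X Y Z : VField I M) : D.curv Y X Z x = - D.curv X Y Z x := by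
  simp only [Conn.curv, Conn.along, mlieBracket_swap (V := Y), Pi.neg_apply, map_neg]
  abel

lemma Conn.curv_add_left (hD : CovariantDerivative.ContMDiffCovariantDerivative D ∞)
    (hX : SmoothNear X x) (hX' : SmoothNear X' x) (hZ : SmoothNear Z x) :
    D.curv (X + X') Y Z x = D.curv X Y Z x + D.curv X' Y Z x := by
  have : CompleteSpace E := FiniteDimensional.complete ℝ E
  have : IsManifold I 2 M := inferInstance
  simp only [Conn.curv, D.along_add_left]
  rw [D.along_add_right _ (hX.along hD hZ) (hX'.along hD hZ)]
  simp only [Conn.along, mlieBracket_add_left hX.mdifferentiableAt hX'.mdifferentiableAt, map_add,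
    Pi.add_apply]
  abel

lemma Conn.curv_smul_left (hD : CovariantDerivative.ContMDiffCovariantDerivative D ∞)
    {f : M → ℝ} (hf : SmoothFunNear I f x) (hX : SmoothNear X x) (hZ : SmoothNear Z x) :
    D.curv (f • X) Y Z x = f x • D.curv X Y Z x := by
  have : CompleteSpace E := FiniteDimensional.complete ℝ E
  have : IsManifold I 2 M := inferInstance
  simp only [Conn.curv, D.along_smul_left]
  rw [D.along_smul_right _ hf (hX.along hD hZ)]
  simp only [Conn.along, mlieBracket_smul_left hf.mdifferentiableAt hX.mdifferentiableAt, map_add,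
    map_smul, Pi.smul_apply', lieDer]
  module

lemma Conn.curv_add_right (hD : CovariantDerivative.ContMDiffCovariantDerivative D ∞)
    (hX : SmoothNear X x) (hY : SmoothNear Y x) (hZ : SmoothNear Z x) (hZ' : SmoothNear Z' x) :
    D.curv X Y (Z + Z') x = D.curv X Y Z x + D.curv X Y Z' x := by
  have key (W : VField I M) : ∀ᶠ y in 𝓝 x, D.along W (Z + Z') y = (D.along W Z + D.along W Z') y := by
    filter_upwards [hZ.eventually, hZ'.eventually] with y h h' using D.along_add_right W h h'
  simp only [Conn.curv]
  rw [D.along_congr X ((hY.along hD hZ).add (hY.along hD hZ')) (key Y),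
    D.along_congr Y ((hX.along hD hZ).add (hX.along hD hZ')) (key X),
    D.along_add_right _ (hY.along hD hZ) (hY.along hD hZ'),
    D.along_add_right _ (hX.along hD hZ) (hX.along hD hZ'), D.along_add_right _ hZ hZ']
  abel

lemma Conn.curv_smul_right [Nontrivial E]
    (hD : CovariantDerivative.ContMDiffCovariantDerivative D ∞) {f : M → ℝ}
    (hf : SmoothFunNear I f x) (hX : SmoothNear X x) (hY : SmoothNear Y x) (hZ : SmoothNear Z x) :
    D.curv X Y (f • Z) x = f x • D.curv X Y Z x := by
  have key (W W' : VField I M) (hW : SmoothNear W x) (hW' : SmoothNear W' x) :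
      D.along W (D.along W' (f • Z)) x = f x • D.along W (D.along W' Z) x
        + lieDer W f x • D.along W' Z x + lieDer W' f x • D.along W Z x
        + lieDer W (lieDer W' f) x • Z x := by
    have h : ∀ᶠ y in 𝓝 x, D.along W' (f • Z) y = (f • D.along W' Z + lieDer W' f • Z) y := by
      filter_upwards [hf.eventually, hZ.eventually] with y h h' using D.along_smul_right W' h h'
    rw [D.along_congr W (((hW'.along hD hZ).smul hf).add (hZ.smul (hf.lieDer hW'))) h,
      D.along_add_right _ ((hW'.along hD hZ).smul hf) (hZ.smul (hf.lieDer hW')),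
      D.along_smul_right _ hf (hW'.along hD hZ), D.along_smul_right _ (hf.lieDer hW') hZ]
    abel
  simp only [Conn.curv]
  rw [key X Y hX hY, key Y X hY hX, D.along_smul_right _ hf hZ, lieDer_mlieBracket hX hY hf]
  module

/-- The curvature at `x` depends only on the values of the vector fields at `x`. -/
lemma Conn.curv_congr [Nontrivial E] (hD : CovariantDerivative.ContMDiffCovariantDerivative D ∞)
    {Y' : VField I M} (hX : SmoothNear X x) (hY : SmoothNear Y x) (hZ : SmoothNear Z x)
    (hX' : SmoothNear X' x) (hY' : SmoothNear Y' x) (hZ' : SmoothNear Z' x)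
    (eX : X x = X' x) (eY : Y x = Y' x) (eZ : Z x = Z' x) :
    D.curv X Y Z x = D.curv X' Y' Z' x := by
  -- Tensoriality in the second slot follows from the first by antisymmetry.
  have left {U U' W : VField I M} (hU : SmoothNear U x) (hU' : SmoothNear U' x) (e : U x = U' x) :
      D.curv U W Z x = D.curv U' W Z x :=
    eq_of_tensorial (Φ := fun U ↦ D.curv U W Z x) (fun _ _ h h' ↦ D.curv_add_left hD h h' hZ)
      (fun _ _ h h' ↦ D.curv_smul_left hD h h' hZ) hU hU' e
  rw [left hX hX' eX, ← neg_inj, ← D.curv_swap, left hY hY' eY, D.curv_swap, neg_inj]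
  exact eq_of_tensorial (Φ := fun U ↦ D.curv X' Y' U x)
    (fun _ _ h h' ↦ D.curv_add_right hD hX' hY' h h')
    (fun _ _ h h' ↦ D.curv_smul_right hD h hX' hY' h') hZ hZ' eZ

end Curvature

end General

/-! ### The half-line and its trivial tangent bundle. -/

section PosReal

lemma posReal_pos (s : PosReal) : 0 < (s : ℝ) := s.2

lemma posReal_ne_zero (s : PosReal) : (s : ℝ) ≠ 0 := (posReal_pos s).ne'

/-- All preferred charts of the half-line are the same restriction of the identity chart of ℝ, so
coordinate changes are trivial. -/
lemma trivializationAt_posReal_snd (s : PosReal) (z : TangentBundle 𝓘(ℝ, ℝ) PosReal) :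
    (trivializationAt ℝ (TangentSpace 𝓘(ℝ, ℝ)) s z).2 = z.2 := by
  change (tangentBundleCore 𝓘(ℝ, ℝ) PosReal).coordChange (achart ℝ z.1) (achart ℝ s) z.1 z.2 = z.2
  exact (tangentBundleCore 𝓘(ℝ, ℝ) PosReal).coordChange_self _ _ (mem_chart_source ℝ z.1) _

lemma contMDiff_posReal_coe {n : ℕ∞ω} :
    ContMDiff 𝓘(ℝ, ℝ) 𝓘(ℝ, ℝ) n (fun s : PosReal ↦ (s : ℝ)) := contMDiff_subtype_val

lemma mfderiv_posReal_coe (s : PosReal) :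
    mfderiv 𝓘(ℝ, ℝ) 𝓘(ℝ, ℝ) (fun s : PosReal ↦ (s : ℝ)) s = ContinuousLinearMap.id ℝ ℝ := by
  rw [(contMDiff_posReal_coe (n := 1) s).mdifferentiableAt (by simp) |>.mfderiv]
  simp only [modelWithCornersSelf_coe, Set.range_id, fderivWithin_univ]
  have : writtenInExtChartAt 𝓘(ℝ, ℝ) 𝓘(ℝ, ℝ) s (fun s : PosReal ↦ (s : ℝ)) =ᶠ[𝓝 (s : ℝ)] id := by
    filter_upwards [extChartAt_target_mem_nhds (I := 𝓘(ℝ, ℝ)) s] with t ht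
    exact (extChartAt 𝓘(ℝ, ℝ) s).right_inv ht
  exact (this.fderiv_eq).trans fderiv_id

lemma mvfderiv_posReal_coe (s : PosReal) (a : TangentSpace 𝓘(ℝ, ℝ) s) :
    mvfderiv 𝓘(ℝ, ℝ) (fun s : PosReal ↦ (s : ℝ)) s a = a := by
  have := DFunLike.congr_fun (mfderiv_posReal_coe s) a
  exact this

end PosReal

/-! ### Tangent vectors of M × ℝ^{>0} split into components. -/

section Product

variable {E : Type*} [NormedAddCommGroup E] [NormedSpace ℝ E]
  {M : Type*} [TopologicalSpace M] [ChartedSpace E M]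

/-- The component of a tangent vector of `M × ℝ^{>0}` which is tangent to `M`. -/
def hor (p : M × PosReal) : TangentSpace (coneModel E) p →L[ℝ] TangentSpace 𝓘(ℝ, E) p.1 :=
  ContinuousLinearMap.fst ℝ E ℝ

/-- The `∂/∂s`-component of a tangent vector of `M × ℝ^{>0}`. -/
def ver (p : M × PosReal) : TangentSpace (coneModel E) p →L[ℝ] ℝ :=
  ContinuousLinearMap.snd ℝ E ℝ

/-- The inclusion of the tangent space of `M` into that of `M × ℝ^{>0}`. -/
def inH (p : M × PosReal) : TangentSpace 𝓘(ℝ, E) p.1 →L[ℝ] TangentSpace (coneModel E) p :=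
  ContinuousLinearMap.inl ℝ E ℝ

/-- The map `a ↦ a ∂/∂s`. -/
def inV (p : M × PosReal) : ℝ →L[ℝ] TangentSpace (coneModel E) p :=
  ContinuousLinearMap.inr ℝ E ℝ

variable (p : M × PosReal) (v : TangentSpace 𝓘(ℝ, E) p.1) (a : ℝ)

@[simp] lemma hor_tvec : hor p (tvec p v a) = v := rfl
@[simp] lemma ver_tvec : ver p (tvec p v a) = a := rfl
@[simp] lemma hor_inH : hor p (inH p v) = v := rfl
@[simp] lemma ver_inH : ver p (inH p v) = 0 := rfl
@[simp] lemma hor_inV : hor (E := E) p (inV p a) = 0 := rfl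
@[simp] lemma ver_inV : ver (E := E) p (inV p a) = a := rfl

variable {p} in
lemma cone_ext {w w' : TangentSpace (coneModel E) p} (h : hor p w = hor p w')
    (h' : ver p w = ver p w') : w = w' := Prod.ext h h'

lemma trivializationAt_self_snd (m : M) (v : TangentSpace 𝓘(ℝ, E) m) [IsManifold 𝓘(ℝ, E) 1 M] :
    (trivializationAt E (TangentSpace 𝓘(ℝ, E)) m ⟨m, v⟩).2 = v := by
  change (tangentBundleCore 𝓘(ℝ, E) M).coordChange (achart E m) (achart E m) m v = v
  exact (tangentBundleCore 𝓘(ℝ, E) M).coordChange_self _ _ (mem_chart_source E m) _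

variable [IsManifold 𝓘(ℝ, E) ∞ M]
  {E' : Type*} [NormedAddCommGroup E'] [NormedSpace ℝ E'] {H' : Type*} [TopologicalSpace H']
  {J : ModelWithCorners ℝ E' H'} {N : Type*} [TopologicalSpace N] [ChartedSpace H' N]
  {x : N} {n : ℕ∞ω}

lemma contMDiffAt_posReal_tangent {s : N → PosReal} {a : N → ℝ} :
    ContMDiffAt J (𝓘(ℝ, ℝ)).tangent n
      (fun y ↦ (⟨s y, a y⟩ : TangentBundle 𝓘(ℝ, ℝ) PosReal)) x ↔
    ContMDiffAt J 𝓘(ℝ, ℝ) n s x ∧ ContMDiffAt J 𝓘(ℝ, ℝ) n a x := by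
  rw [Bundle.contMDiffAt_totalSpace]
  simp only [trivializationAt_posReal_snd]

lemma mdifferentiableAt_posReal_tangent {s : N → PosReal} {a : N → ℝ} :
    MDifferentiableAt J (𝓘(ℝ, ℝ)).tangent
      (fun y ↦ (⟨s y, a y⟩ : TangentBundle 𝓘(ℝ, ℝ) PosReal)) x ↔
    MDifferentiableAt J 𝓘(ℝ, ℝ) s x ∧ MDifferentiableAt J 𝓘(ℝ, ℝ) a x := by
  rw [mdifferentiableAt_totalSpace]
  simp only [trivializationAt_posReal_snd]

/-- T(M × ℝ^{>0}) is TM × Tℝ^{>0}, and the second factor is trivial. The bound on n reflects that M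
is only C^∞. -/
lemma contMDiffAt_cone_tangent {f : N → M × PosReal}
    {w : ∀ y, TangentSpace (coneModel E) (f y)} (hn : n ≤ ∞) :
    ContMDiffAt J (coneModel E).tangent n
      (fun y ↦ (⟨f y, w y⟩ : TangentBundle (coneModel E) (M × PosReal))) x ↔
    ContMDiffAt J (𝓘(ℝ, E)).tangent n
      (fun y ↦ (⟨(f y).1, hor (f y) (w y)⟩ : TangentBundle 𝓘(ℝ, E) M)) x ∧
    ContMDiffAt J 𝓘(ℝ, ℝ) n (fun y ↦ (f y).2) x ∧
    ContMDiffAt J 𝓘(ℝ, ℝ) n (fun y ↦ ver (f y) (w y)) x := by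
  rw [← contMDiffAt_posReal_tangent]
  refine ⟨fun h ↦ ?_, fun h ↦ ?_⟩
  · have := (contMDiff_equivTangentBundleProd (I := 𝓘(ℝ, E)) (M := M) (I' := 𝓘(ℝ, ℝ))
      (M' := PosReal) (n := ∞)).of_le hn |>.contMDiffAt.comp x h
    exact ⟨contMDiffAt_fst.comp x this, contMDiffAt_snd.comp x this⟩
  · exact (contMDiff_equivTangentBundleProd_symm (I := 𝓘(ℝ, E)) (M := M) (I' := 𝓘(ℝ, ℝ))
      (M' := PosReal) (n := ∞)).of_le hn |>.contMDiffAt.comp x (h.1.prodMk h.2)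

lemma mdifferentiableAt_cone_tangent {f : N → M × PosReal}
    {w : ∀ y, TangentSpace (coneModel E) (f y)} :
    MDifferentiableAt J (coneModel E).tangent
      (fun y ↦ (⟨f y, w y⟩ : TangentBundle (coneModel E) (M × PosReal))) x ↔
    MDifferentiableAt J (𝓘(ℝ, E)).tangent
      (fun y ↦ (⟨(f y).1, hor (f y) (w y)⟩ : TangentBundle 𝓘(ℝ, E) M)) x ∧
    MDifferentiableAt J 𝓘(ℝ, ℝ) (fun y ↦ (f y).2) x ∧
    MDifferentiableAt J 𝓘(ℝ, ℝ) (fun y ↦ ver (f y) (w y)) x := by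
  rw [← mdifferentiableAt_posReal_tangent]
  refine ⟨fun h ↦ ?_, fun h ↦ ?_⟩
  · have := (contMDiff_equivTangentBundleProd (I := 𝓘(ℝ, E)) (M := M) (I' := 𝓘(ℝ, ℝ))
      (M' := PosReal) (n := 1)).mdifferentiableAt (by simp) |>.comp x h
    exact ⟨mdifferentiableAt_fst.comp x this, mdifferentiableAt_snd.comp x this⟩
  · exact (contMDiff_equivTangentBundleProd_symm (I := 𝓘(ℝ, E)) (M := M) (I' := 𝓘(ℝ, ℝ))
      (M' := PosReal) (n := 1)).mdifferentiableAt (by simp) |>.comp x (h.1.prodMk h.2)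

end Product

/-! ### The connection ∇ on the cone. -/

section ConeConnection

variable {E : Type*} [NormedAddCommGroup E] [NormedSpace ℝ E]
  {M : Type*} [TopologicalSpace M] [ChartedSpace E M] [IsManifold 𝓘(ℝ, E) ∞ M]

/-- The restriction to `M × {s}` of the component of a vector field which is tangent to `M`. -/
def slice (Z : VField (coneModel E) (M × PosReal)) (s : PosReal) : VField 𝓘(ℝ, E) M :=
  fun m ↦ hor (m, s) (Z (m, s))

/-- The component of a vector field which is tangent to `M`, along the line `{m} × ℝ^{>0}`. -/
def lineMap (Z : VField (coneModel E) (M × PosReal)) (m : M) : PosReal → E :=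
  fun s ↦ slice Z s m

/-- The derivative along `∂/∂s` of the component of a vector field which is tangent to `M`. -/
def slicePartial (Z : VField (coneModel E) (M × PosReal)) (p : M × PosReal) :
    TangentSpace 𝓘(ℝ, E) p.1 :=
  mvfderiv 𝓘(ℝ, ℝ) (lineMap Z p.1) p.2 (1 : ℝ)

variable {Z Z' : VField (coneModel E) (M × PosReal)} {p : M × PosReal}

lemma mdifferentiableAt_slice (h : MDifferentiableAt (coneModel E) (coneModel E).tangent
      (fun z ↦ (⟨z, Z z⟩ : TangentBundle (coneModel E) (M × PosReal))) p) :
    MDifferentiableAt 𝓘(ℝ, E) (𝓘(ℝ, E)).tangent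
      (fun m ↦ (⟨m, slice Z p.2 m⟩ : TangentBundle 𝓘(ℝ, E) M)) p.1 := by
  have h1 := (mdifferentiableAt_cone_tangent.1 h).1
  have h2 : MDifferentiableAt 𝓘(ℝ, E) (coneModel E) (fun m : M ↦ (m, p.2)) p.1 :=
    mdifferentiableAt_id.prodMk mdifferentiableAt_const
  exact MDifferentiableAt.comp (f := fun m : M ↦ (m, p.2)) p.1 h1 h2

/-- Along {m} × ℝ^{>0} the horizontal component stays in the single space T_m M, on which the
preferred trivialization at m is the identity; so it is an ordinary E-valued function of s. -/
lemma mdifferentiableAt_lineMap (h : MDifferentiableAt (coneModel E) (coneModel E).tangent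
      (fun z ↦ (⟨z, Z z⟩ : TangentBundle (coneModel E) (M × PosReal))) p) :
    MDifferentiableAt 𝓘(ℝ, ℝ) 𝓘(ℝ, E) (lineMap Z p.1) p.2 := by
  have h1 := (mdifferentiableAt_cone_tangent.1 h).1
  have h2 : MDifferentiableAt 𝓘(ℝ, ℝ) (coneModel E) (fun s : PosReal ↦ (p.1, s)) p.2 :=
    mdifferentiableAt_const.prodMk mdifferentiableAt_id
  have h3 := MDifferentiableAt.comp (f := fun s : PosReal ↦ (p.1, s)) p.2 h1 h2
  have h4 := ((mdifferentiableAt_totalSpace _ _).1 h3).2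
  refine h4.congr_of_eventuallyEq (.of_forall fun s ↦ ?_)
  exact (trivializationAt_self_snd p.1 (slice Z s p.1)).symm

lemma mdifferentiableAt_ver (h : MDifferentiableAt (coneModel E) (coneModel E).tangent
      (fun z ↦ (⟨z, Z z⟩ : TangentBundle (coneModel E) (M × PosReal))) p) :
    MDifferentiableAt (coneModel E) 𝓘(ℝ, ℝ) (fun q ↦ ver q (Z q)) p :=
  (mdifferentiableAt_cone_tangent.1 h).2.2

/-- The partial derivative of a function along `∂/∂s`. -/
def partialS (f : M × PosReal → ℝ) (p : M × PosReal) : ℝ :=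
  mvfderiv 𝓘(ℝ, ℝ) (fun s : PosReal ↦ f (p.1, s)) p.2 (1 : ℝ)

lemma mvfderiv_cone {f : M × PosReal → ℝ} (hf : MDifferentiableAt (coneModel E) 𝓘(ℝ, ℝ) f p)
    (w : TangentSpace (coneModel E) p) :
    mvfderiv (coneModel E) f p w =
      mvfderiv 𝓘(ℝ, E) (fun m ↦ f (m, p.2)) p.1 (hor p w) + ver p w * partialS f p := by
  refine (mfderiv_prod_eq_add_apply (v := w) hf).trans ?_
  refine congrArg (_ + ·) ?_
  have : mvfderiv 𝓘(ℝ, ℝ) (fun s : PosReal ↦ f (p.1, s)) p.2 (ver p w • (1 : ℝ)) =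
    ver p w * partialS f p := map_smul _ _ _
  rw [smul_eq_mul, mul_one] at this
  exact this

lemma slicePartial_add (h : MDifferentiableAt (coneModel E) (coneModel E).tangent
      (fun z ↦ (⟨z, Z z⟩ : TangentBundle (coneModel E) (M × PosReal))) p)
    (h' : MDifferentiableAt (coneModel E) (coneModel E).tangent
      (fun z ↦ (⟨z, Z' z⟩ : TangentBundle (coneModel E) (M × PosReal))) p) :
    slicePartial (Z + Z') p = slicePartial Z p + slicePartial Z' p := by
  have := mvfderiv_add (mdifferentiableAt_lineMap h) (mdifferentiableAt_lineMap h')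
  have hl : lineMap (Z + Z') p.1 = lineMap Z p.1 + lineMap Z' p.1 := rfl
  rw [slicePartial, hl]
  exact DFunLike.congr_fun this (1 : ℝ)

lemma slicePartial_smul {f : M × PosReal → ℝ}
    (h : MDifferentiableAt (coneModel E) (coneModel E).tangent
      (fun z ↦ (⟨z, Z z⟩ : TangentBundle (coneModel E) (M × PosReal))) p)
    (hf : MDifferentiableAt (coneModel E) 𝓘(ℝ, ℝ) f p) :
    slicePartial (f • Z) p = f p • slicePartial Z p + partialS f p • hor p (Z p) := by
  have h2 : MDifferentiableAt 𝓘(ℝ, ℝ) (coneModel E) (fun s : PosReal ↦ (p.1, s)) p.2 :=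
    mdifferentiableAt_const.prodMk mdifferentiableAt_id
  have hf' : MDifferentiableAt 𝓘(ℝ, ℝ) 𝓘(ℝ, ℝ) (fun s : PosReal ↦ f (p.1, s)) p.2 :=
    MDifferentiableAt.comp (f := fun s : PosReal ↦ (p.1, s)) p.2 hf h2
  have := mvfderiv_smul hf' (mdifferentiableAt_lineMap h)
  exact DFunLike.congr_fun this (1 : ℝ)

/-- The connection on `M × ℝ^{>0}` with `∇_X Y = D_X Y - c g(X, Y) ρ`, `∇_X ρ = ∇_ρ X = X` and
`∇_ρ ρ = ρ` for vector fields `X`, `Y` on `M`, where `ρ = l s ∂/∂s`. -/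
def coneConnFun (D : Conn 𝓘(ℝ, E) M) (g : Metric 𝓘(ℝ, E) M) (c l : ℝ)
    (Z : VField (coneModel E) (M × PosReal)) (p : M × PosReal) :
    TangentSpace (coneModel E) p →L[ℝ] TangentSpace (coneModel E) p :=
  inH p ∘L (D (slice Z p.2) p.1 ∘L hor p
      + (ver p).smulRight (slicePartial Z p + (l * p.2 : ℝ)⁻¹ • hor p (Z p))
      + ((l * p.2 : ℝ)⁻¹ * ver p (Z p)) • hor p)
  + inV p ∘L (mvfderiv (coneModel E) (fun q ↦ ver q (Z q)) p
      -- The vertical part of Z is uρ with u = ver Z / (λs), and ∇_w(uρ) = w(u) ρ + u w.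
      -- Differentiating 1/s in u gives the -1, and the vertical part of u w gives the λ⁻¹.
      + ((l⁻¹ - 1) / p.2 * ver p (Z p)) • ver p
      - (c * l * p.2 : ℝ) • (g.inner p.1 (hor p (Z p)) ∘L hor p))

variable (D : Conn 𝓘(ℝ, E) M) (g : Metric 𝓘(ℝ, E) M) (c l : ℝ)

@[simp] lemma hor_coneConnFun (w : TangentSpace (coneModel E) p) :
    hor p (coneConnFun D g c l Z p w) = D (slice Z p.2) p.1 (hor p w)
      + ver p w • (slicePartial Z p + (l * p.2 : ℝ)⁻¹ • hor p (Z p))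
      + ((l * p.2 : ℝ)⁻¹ * ver p (Z p)) • hor p w := by
  simp [coneConnFun]

@[simp] lemma ver_coneConnFun (w : TangentSpace (coneModel E) p) :
    ver p (coneConnFun D g c l Z p w) = mvfderiv (coneModel E) (fun q ↦ ver q (Z q)) p w
      + (l⁻¹ - 1) / p.2 * ver p (Z p) * ver p w
      - c * l * p.2 * g.inner p.1 (hor p (Z p)) (hor p w) := by
  simp [coneConnFun]

lemma slice_add (s : PosReal) : slice (Z + Z') s = slice Z s + slice Z' s := by
  ext1 m; simp [slice]

lemma slice_smul (f : M × PosReal → ℝ) (s : PosReal) :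
    slice (f • Z) s = (fun m ↦ f (m, s)) • slice Z s := by
  ext1 m; simp [slice]

/-- The connection `coneConnFun`, as a bundled connection. -/
def coneConn : Conn (coneModel E) (M × PosReal) where
  toFun := coneConnFun D g c l
  isCovariantDerivativeOnUniv := by
    constructor
    · intro Z Z' p h h' _
      ext1 w
      have hv : mvfderiv (coneModel E) (fun q ↦ ver q ((Z + Z') q)) p w =
          mvfderiv (coneModel E) (fun q ↦ ver q (Z q)) p w
            + mvfderiv (coneModel E) (fun q ↦ ver q (Z' q)) p w := by
        have := mvfderiv_add (mdifferentiableAt_ver h) (mdifferentiableAt_ver h')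
        simpa using! DFunLike.congr_fun this w
      apply cone_ext
      · simp [slice_add, slicePartial_add h h', D.isCovariantDerivativeOnUniv.add
          (mdifferentiableAt_slice h) (mdifferentiableAt_slice h')]
        module
      · simp only [ver_coneConnFun, hv]
        simp only [Pi.add_apply, map_add, add_apply, ver_coneConnFun]
        ring
    · intro Z f p h hf _
      ext1 w
      have h2 : MDifferentiableAt 𝓘(ℝ, E) (coneModel E) (fun m : M ↦ (m, p.2)) p.1 :=
        mdifferentiableAt_id.prodMk mdifferentiableAt_const
      have hf' : MDifferentiableAt 𝓘(ℝ, E) 𝓘(ℝ, ℝ) (fun m : M ↦ f (m, p.2)) p.1 :=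
        MDifferentiableAt.comp (f := fun m : M ↦ (m, p.2)) p.1 hf h2
      have hv : mvfderiv (coneModel E) (fun q ↦ ver q ((f • Z) q)) p w =
          f p * mvfderiv (coneModel E) (fun q ↦ ver q (Z q)) p w
            + mvfderiv (coneModel E) f p w * ver p (Z p) := by
        have := mvfderiv_smul hf (mdifferentiableAt_ver h)
        have := DFunLike.congr_fun this w
        simp only [add_apply, smul_apply, smul_eq_mul,
          ContinuousLinearMap.smulRight_apply] at this
        rw [← this]
        congr 2
      apply cone_ext
      · simp [slice_smul, slicePartial_smul h hf, D.isCovariantDerivativeOnUniv.leibniz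
          (mdifferentiableAt_slice h) hf', mvfderiv_cone hf]
        simp only [slice]
        module
      · simp only [ver_coneConnFun, hv]
        simp
        ring

lemma coneConn_apply : coneConn D g c l Z p = coneConnFun D g c l Z p := rfl

end ConeConnection

/-! ### Computing ∇ on fields X + fρ. -/

section ConeField

open VectorField

variable {E : Type*} [NormedAddCommGroup E] [NormedSpace ℝ E]
  {M : Type*} [TopologicalSpace M] [ChartedSpace E M] [IsManifold 𝓘(ℝ, E) ∞ M]

/-- The vector field `X + f ρ` on `M × ℝ^{>0}`, for a vector field `X` and a function `f` on `M`,
where `ρ = l s ∂/∂s`. -/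
def coneField (l : ℝ) (X : VField 𝓘(ℝ, E) M) (f : M → ℝ) :
    VField (coneModel E) (M × PosReal) :=
  fun q ↦ tvec q (X q.1) (f q.1 * (l * q.2))

variable {X Y : VField 𝓘(ℝ, E) M} {f h : M → ℝ} {p : M × PosReal} {l c : ℝ}
  {D : Conn 𝓘(ℝ, E) M} {g : Metric 𝓘(ℝ, E) M}

lemma contMDiffAt_snd_coe {n : ℕ∞ω} :
    ContMDiffAt (coneModel E) 𝓘(ℝ, ℝ) n (fun q : M × PosReal ↦ (q.2 : ℝ)) p :=
  contMDiff_posReal_coe.contMDiffAt.comp p contMDiffAt_snd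

lemma partialS_snd_coe : partialS (fun q : M × PosReal ↦ (q.2 : ℝ)) p = 1 :=
  mvfderiv_posReal_coe p.2 (1 : ℝ)

lemma mvfderiv_snd_coe (w : TangentSpace (coneModel E) p) :
    mvfderiv (coneModel E) (fun q : M × PosReal ↦ (q.2 : ℝ)) p w = ver p w := by
  have h0 : mvfderiv 𝓘(ℝ, E) (fun m : M ↦ (((m, p.2) : M × PosReal).2 : ℝ)) p.1 = 0 :=
    mvfderiv_const (p.2 : ℝ)
  rw [mvfderiv_cone ((contMDiffAt_snd_coe (n := 1)).mdifferentiableAt (by simp)),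
    partialS_snd_coe, h0]
  simp

lemma mvfderiv_fst_comp (hf : MDifferentiableAt 𝓘(ℝ, E) 𝓘(ℝ, ℝ) f p.1)
    (w : TangentSpace (coneModel E) p) :
    mvfderiv (coneModel E) (fun q : M × PosReal ↦ f q.1) p w =
      mvfderiv 𝓘(ℝ, E) f p.1 (hor p w) := by
  have : MDifferentiableAt (coneModel E) 𝓘(ℝ, ℝ) (fun q : M × PosReal ↦ f q.1) p :=
    MDifferentiableAt.comp p hf mdifferentiableAt_fst
  have h0 : partialS (fun q : M × PosReal ↦ f q.1) p = 0 :=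
    DFunLike.congr_fun (mvfderiv_const (I := 𝓘(ℝ, ℝ)) (x := p.2) (f p.1)) (1 : ℝ)
  rw [mvfderiv_cone this, h0, mul_zero, add_zero]

lemma SmoothNear.coneField (l : ℝ) (hX : SmoothNear X p.1)
    (hf : SmoothFunNear 𝓘(ℝ, E) f p.1) : SmoothNear (coneField l X f) p := by
  have h1 : ∀ᶠ q : M × PosReal in 𝓝 p, _ := continuousAt_fst.eventually hX
  have h2 : ∀ᶠ q : M × PosReal in 𝓝 p, _ := continuousAt_fst.eventually hf
  filter_upwards [h1, h2] with q h1 h2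
  refine (contMDiffAt_cone_tangent le_rfl).2 ⟨h1.comp q contMDiffAt_fst, contMDiffAt_snd, ?_⟩
  exact (h2.comp q contMDiffAt_fst).mul (contMDiffAt_const.mul contMDiffAt_snd_coe)

lemma hor_coneField : hor p (coneField l X f p) = X p.1 := rfl
lemma ver_coneField : ver p (coneField l X f p) = f p.1 * (l * p.2) := rfl

/-- The working formula behind the torsion, smoothness and curvature computations. Only h has to be
differentiable: Y does not depend on s, so its s-derivative vanishes, and its slices are Y itself,
so D applies to it as is. -/
lemma along_coneField (hl : l ≠ 0) (hh : MDifferentiableAt 𝓘(ℝ, E) 𝓘(ℝ, ℝ) h p.1) :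
    (coneConn D g c l).along (coneField l X f) (coneField l Y h) p =
      coneField l (D.along X Y + h • X + f • Y)
        (fun m ↦ lieDer X h m + f m * h m - c * g.ap X Y m) p := by
  have hs := posReal_ne_zero p.2
  have hP : slicePartial (coneField l Y h) p = 0 := by
    exact DFunLike.congr_fun
      (mvfderiv_const (I := 𝓘(ℝ, ℝ)) (F := E) (x := p.2) (Y p.1)) (1 : ℝ)
  have hv (w : TangentSpace (coneModel E) p) :
      mvfderiv (coneModel E) (fun q ↦ ver q (coneField l Y h q)) p w =
        mvfderiv 𝓘(ℝ, E) h p.1 (hor p w) * (l * p.2) + h p.1 * (l * ver p w) := by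
    have h1 : MDifferentiableAt (coneModel E) 𝓘(ℝ, ℝ) (fun q : M × PosReal ↦ h q.1) p :=
      MDifferentiableAt.comp p hh mdifferentiableAt_fst
    have h2 : MDifferentiableAt (coneModel E) 𝓘(ℝ, ℝ) (fun q : M × PosReal ↦ (q.2 : ℝ)) p :=
      (contMDiffAt_snd_coe (n := 1)).mdifferentiableAt (by simp)
    have h3 : MDifferentiableAt (coneModel E) 𝓘(ℝ, ℝ) (fun _ : M × PosReal ↦ l) p :=
      mdifferentiableAt_const
    have e1 := DFunLike.congr_fun (mvfderiv_mul h1 (h3.mul h2)) w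
    have e2 := DFunLike.congr_fun (mvfderiv_mul h3 h2) w
    refine e1.trans ?_
    simp only [add_apply, smul_apply, smul_eq_mul, e2,
      mvfderiv_const, mvfderiv_snd_coe, mvfderiv_fst_comp hh, Pi.mul_apply, zero_apply]
    ring
  apply cone_ext
  · rw [Conn.along, coneConn_apply, hor_coneConnFun, hP]
    simp only [hor_coneField, ver_coneField, Pi.add_apply, Pi.smul_apply', Conn.along]
    have : slice (coneField l Y h) p.2 = Y := rfl
    rw [this]
    match_scalars <;> field_simp
  · rw [Conn.along, coneConn_apply, ver_coneConnFun, hv]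
    simp only [hor_coneField, ver_coneField, lieDer, Metric.ap, g.symm p.1 (Y p.1)]
    field_simp
    ring

end ConeField

/-! ### Commuting coordinate fields and vanishing torsion. -/

section Torsion

open VectorField

variable {E : Type*} [NormedAddCommGroup E] [NormedSpace ℝ E] [FiniteDimensional ℝ E]
  {M : Type*} [TopologicalSpace M] [ChartedSpace E M] [IsManifold 𝓘(ℝ, E) ∞ M]

/-- The vector field with constant coefficients `e` in the chart at `m`. -/
def chartField (m : M) (e : E) : VField 𝓘(ℝ, E) M :=
  mpullback 𝓘(ℝ, E) 𝓘(ℝ, E) (extChartAt 𝓘(ℝ, E) m) (fun _ ↦ e)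

variable {N F : Type*} [NormedAddCommGroup F] [NormedSpace ℝ F] [FiniteDimensional ℝ F]
  {H' : Type*} [TopologicalSpace H'] {J : ModelWithCorners ℝ F H'} [TopologicalSpace N]
  [ChartedSpace H' N] [IsManifold J ∞ N]

/-- The bracket is natural under pullback, and constant fields on a vector space commute. -/
lemma mlieBracket_mpullback_const {φ : N → F} {x : N} (hφ : ContMDiffAt J 𝓘(ℝ, F) ∞ φ x)
    (e e' : F) :
    mlieBracket J (mpullback J 𝓘(ℝ, F) φ (fun _ ↦ e)) (mpullback J 𝓘(ℝ, F) φ (fun _ ↦ e')) x = 0 := by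
  have : CompleteSpace F := FiniteDimensional.complete ℝ F
  have : IsManifold J (minSmoothness ℝ 2) N := by
    rw [minSmoothness_of_isRCLikeNormedField]; infer_instance
  have hc (e : F) : MDifferentiableAt 𝓘(ℝ, F) (𝓘(ℝ, F)).tangent
      (fun y ↦ (⟨y, e⟩ : TangentBundle 𝓘(ℝ, F) F)) (φ x) :=
    ((contMDiffAt_vectorSpace_iff_contDiffAt (n := 1) (V := fun _ ↦ e)).2
      contDiffAt_const).mdifferentiableAt (by simp)
  rw [← mpullback_mlieBracket (n := ∞) (hc e) (hc e') hφ (by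
    rw [minSmoothness_of_isRCLikeNormedField]; exact ENat.LEInfty.out)]
  have : mlieBracket 𝓘(ℝ, F) (fun _ : F ↦ e) (fun _ ↦ e') (φ x) = 0 := by
    refine (congrFun (mlieBracketWithin_eq_lieBracketWithin (s := Set.univ)) (φ x)).trans ?_
    simp [lieBracketWithin]
    rfl
  rw [mpullback_apply, this, map_zero]

end Torsion

section ConeTorsion

open VectorField

variable {E : Type*} [NormedAddCommGroup E] [NormedSpace ℝ E] [FiniteDimensional ℝ E]
  {M : Type*} [TopologicalSpace M] [ChartedSpace E M] [IsManifold 𝓘(ℝ, E) ∞ M]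
  {D : Conn 𝓘(ℝ, E) M} {g : Metric 𝓘(ℝ, E) M} {c l : ℝ}

lemma torsion_apply_eq_zero {H : Type*} [TopologicalSpace H] {I : ModelWithCorners ℝ E H}
    {M : Type*} [TopologicalSpace M] [ChartedSpace H M] [IsManifold I ∞ M] {D : Conn I M}
    (hD : IsTorsionFreeConn D) {X Y : VField I M} {x : M}
    (hX : MDifferentiableAt I I.tangent (fun z ↦ (⟨z, X z⟩ : TangentBundle I M)) x)
    (hY : MDifferentiableAt I I.tangent (fun z ↦ (⟨z, Y z⟩ : TangentBundle I M)) x) :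
    D Y x (X x) - D X x (Y x) = mlieBracket I X Y x := by
  have : CompleteSpace E := FiniteDimensional.complete ℝ E
  exact (CovariantDerivative.torsion_eq_zero_iff D).1 hD.torsion_free hX hY

lemma chartField_self (m : M) (v : TangentSpace 𝓘(ℝ, E) m) :
    chartField (E := E) m (mfderiv 𝓘(ℝ, E) 𝓘(ℝ, E) (extChartAt 𝓘(ℝ, E) m) m v) m = v := by
  have h := isInvertible_mfderiv_extChartAt (I := 𝓘(ℝ, E)) (mem_extChartAt_source (I := 𝓘(ℝ, E)) m)
  exact h.inverse_apply_self v

lemma smoothNear_chartField (m : M) (e : E) : SmoothNear (chartField m e : VField 𝓘(ℝ, E) M) m := by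
  have : CompleteSpace E := FiniteDimensional.complete ℝ E
  filter_upwards [extChartAt_source_mem_nhds (I := 𝓘(ℝ, E)) m] with y hy
  refine ContMDiffAt.mpullback_vectorField_preimage (n := ∞) ?_ ?_
    (isInvertible_mfderiv_extChartAt hy) (by simp)
  · exact (contMDiffAt_vectorSpace_iff_contDiffAt (V := fun _ ↦ e)).2 contDiffAt_const
  · exact contMDiffAt_extChartAt' (by simpa using hy)

/-- Adapted coordinates on `M × ℝ^{>0}`, in which `ρ = l s ∂/∂s` is a coordinate field. -/
def coneChart (l : ℝ) (m : M) (q : M × PosReal) : E × ℝ :=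
  (extChartAt 𝓘(ℝ, E) m q.1, l⁻¹ * Real.log q.2)

lemma contMDiffAt_coneChart {m : M} {q : M × PosReal} (hq : q.1 ∈ (extChartAt 𝓘(ℝ, E) m).source) :
    ContMDiffAt (coneModel E) 𝓘(ℝ, E × ℝ) ∞ (coneChart (E := E) l m) q := by
  refine ContMDiffAt.prodMk_space ?_ (contMDiffAt_const.mul ?_)
  · exact (contMDiffAt_extChartAt' (by simpa using hq)).comp q contMDiffAt_fst
  · exact ((Real.contDiffAt_log.2 (posReal_ne_zero q.2)).contMDiffAt).comp q
      (contMDiffAt_snd_coe (E := E))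

lemma mfderiv_coneChart {m : M} {q : M × PosReal} (hq : q.1 ∈ (extChartAt 𝓘(ℝ, E) m).source)
    (w : TangentSpace (coneModel E) q) :
    mfderiv (coneModel E) 𝓘(ℝ, E × ℝ) (coneChart (E := E) l m) q w =
      (mfderiv 𝓘(ℝ, E) 𝓘(ℝ, E) (extChartAt 𝓘(ℝ, E) m) q.1 (hor q w),
        ver q w / (l * q.2)) := by
  have h1 : HasMFDerivAt (coneModel E) 𝓘(ℝ, E) (fun q : M × PosReal ↦ extChartAt 𝓘(ℝ, E) m q.1) q
      ((mfderiv 𝓘(ℝ, E) 𝓘(ℝ, E) (extChartAt 𝓘(ℝ, E) m) q.1).comp (hor q)) :=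
    HasMFDerivAt.comp q ((mdifferentiableAt_extChartAt (by simpa using hq)).hasMFDerivAt)
      (hasMFDerivAt_fst q)
  have h2 : HasMFDerivAt (coneModel E) 𝓘(ℝ, ℝ) (fun q : M × PosReal ↦ (q.2 : ℝ)) q (ver q) := by
    have := ((contMDiffAt_snd_coe (E := E) (p := q) (n := 1)).mdifferentiableAt
      (by simp)).hasMFDerivAt
    have e : mfderiv (coneModel E) 𝓘(ℝ, ℝ) (fun q : M × PosReal ↦ (q.2 : ℝ)) q = ver q :=
      ContinuousLinearMap.ext fun w ↦ mvfderiv_snd_coe w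
    exact e ▸ this
  have h3 : HasMFDerivAt (coneModel E) 𝓘(ℝ, ℝ)
      (fun q : M × PosReal ↦ l⁻¹ * Real.log q.2) q
      ((ContinuousLinearMap.toSpanSingleton ℝ (l⁻¹ * (q.2 : ℝ)⁻¹)).comp (ver q)) :=
    HasMFDerivAt.comp (f := fun q : M × PosReal ↦ (q.2 : ℝ))
      (g := fun t : ℝ ↦ l⁻¹ * Real.log t) q
      (((Real.hasDerivAt_log (posReal_ne_zero q.2)).const_mul l⁻¹).hasFDerivAt.hasMFDerivAt) h2
  have h4 : HasMFDerivAt (coneModel E) 𝓘(ℝ, E × ℝ) (coneChart (E := E) l m) q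
      (((mfderiv 𝓘(ℝ, E) 𝓘(ℝ, E) (extChartAt 𝓘(ℝ, E) m) q.1).comp (hor q)).prod
        ((ContinuousLinearMap.toSpanSingleton ℝ (l⁻¹ * (q.2 : ℝ)⁻¹)).comp (ver q))) :=
    ⟨h1.1.prodMk h3.1, h1.2.prodMk h3.2⟩
  rw [HasMFDerivAt.mfderiv h4]
  refine Prod.ext rfl ?_
  change ver q w • (l⁻¹ * (q.2 : ℝ)⁻¹) = _
  simp [div_eq_mul_inv, mul_comm]

lemma isInvertible_mfderiv_coneChart (hl : l ≠ 0) {m : M} {q : M × PosReal}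
    (hq : q.1 ∈ (extChartAt 𝓘(ℝ, E) m).source) :
    (mfderiv (coneModel E) 𝓘(ℝ, E × ℝ) (coneChart (E := E) l m) q).IsInvertible := by
  obtain ⟨B, hB⟩ := isInvertible_mfderiv_extChartAt (I := 𝓘(ℝ, E)) hq
  have hs : (l * (q.2 : ℝ))⁻¹ ≠ 0 := inv_ne_zero (mul_ne_zero hl (posReal_ne_zero q.2))
  let B' : E ≃L[ℝ] E := B
  -- The second factor is multiplication by 1/(λs), the derivative of λ⁻¹ log s.
  refine ⟨B'.prodCongr (ContinuousLinearEquiv.unitsEquivAut ℝ (Units.mk0 _ hs)), ?_⟩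
  refine ContinuousLinearMap.ext fun w ↦ ?_
  rw [mfderiv_coneChart hq, ← hB]
  rfl

lemma mpullback_coneChart (hl : l ≠ 0) {m : M} {q : M × PosReal}
    (hq : q.1 ∈ (extChartAt 𝓘(ℝ, E) m).source) (e : E) (a : ℝ) :
    mpullback (coneModel E) 𝓘(ℝ, E × ℝ) (coneChart (E := E) l m) (fun _ ↦ (e, a)) q =
      coneField l (chartField m e) (fun _ ↦ a) q := by
  refine (isInvertible_mfderiv_coneChart hl hq).inverse_apply_eq.2 ?_
  rw [mfderiv_coneChart hq]
  have hs := posReal_ne_zero q.2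
  refine Prod.ext ?_ ?_
  · exact ((isInvertible_mfderiv_extChartAt (I := 𝓘(ℝ, E)) hq).inverse_apply_eq.1 rfl)
  · change a = ver q (coneField l (chartField m e) (fun _ ↦ a) q) / (l * q.2)
    rw [ver_coneField]
    field_simp

lemma coneField_eq_self (hl : l ≠ 0) (p : M × PosReal) (w : TangentSpace (coneModel E) p)
    {X : VField 𝓘(ℝ, E) M} (hX : X p.1 = hor p w) :
    coneField l X (fun _ ↦ ver p w / (l * p.2)) p = w := by
  have hs := posReal_ne_zero p.2
  apply cone_ext
  · exact hX
  · rw [ver_coneField]; field_simp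

/-- Torsion is a tensor, so it may be tested on coordinate fields of `coneChart`. These have the
form X + aρ with X a coordinate field of M and a constant, and they commute. It remains that ∇_U V
is symmetric in U and V, which holds since D_X Y = D_Y X for commuting X, Y. -/
lemma coneConn_torsion (hD : IsTorsionFreeConn D) (hl : l ≠ 0) :
    haveI : CompleteSpace (E × ℝ) := FiniteDimensional.complete ℝ (E × ℝ)
    (coneConn D g c l).torsion = 0 := by
  have : CompleteSpace (E × ℝ) := FiniteDimensional.complete ℝ (E × ℝ)
  ext1 p
  have hsrc : ∀ᶠ q : M × PosReal in 𝓝 p, q.1 ∈ (extChartAt 𝓘(ℝ, E) p.1).source :=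
    continuousAt_fst.eventually (extChartAt_source_mem_nhds (I := 𝓘(ℝ, E)) p.1)
  have key (v : TangentSpace (coneModel E) p) : ∃ (e : E) (a : ℝ),
      coneField l (chartField p.1 e) (fun _ ↦ a) p = v :=
    ⟨mfderiv 𝓘(ℝ, E) 𝓘(ℝ, E) (extChartAt 𝓘(ℝ, E) p.1) p.1 (hor p v), _,
      coneField_eq_self hl p v (chartField_self p.1 (hor p v))⟩
  refine ContinuousLinearMap.ext fun v ↦ ContinuousLinearMap.ext fun w ↦ ?_
  obtain ⟨e, a, rfl⟩ := key v
  obtain ⟨e', a', rfl⟩ := key w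
  have hs (e : E) (a : ℝ) : SmoothNear (coneField l (chartField p.1 e) (fun _ ↦ a)) p :=
    (smoothNear_chartField p.1 e).coneField l (.const a)
  have h0 : mlieBracket (coneModel E) (coneField l (chartField p.1 e) (fun _ ↦ a))
      (coneField l (chartField p.1 e') (fun _ ↦ a')) p = 0 := by
    rw [← mlieBracket_mpullback_const (contMDiffAt_coneChart (l := l) hsrc.self_of_nhds)
      (e, a) (e', a')]
    refine (Filter.EventuallyEq.mlieBracket_vectorField_eq ?_ ?_).symm
    · exact hsrc.mono fun q hq ↦ mpullback_coneChart hl hq e a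
    · exact hsrc.mono fun q hq ↦ mpullback_coneChart hl hq e' a'
  have h0' : mlieBracket 𝓘(ℝ, E) (chartField p.1 e) (chartField p.1 e') p.1 = 0 :=
    mlieBracket_mpullback_const contMDiffAt_extChartAt e e'
  rw [← torsion_apply_eq_zero hD (smoothNear_chartField p.1 e).mdifferentiableAt
    (smoothNear_chartField p.1 e').mdifferentiableAt, sub_eq_zero] at h0'
  rw [CovariantDerivative.torsion_apply _ (hs e a).mdifferentiableAt (hs e' a').mdifferentiableAt,
    h0, sub_zero]
  change (coneConn D g c l).along (coneField l (chartField p.1 e) fun _ ↦ a)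
    (coneField l (chartField p.1 e') fun _ ↦ a') p - (coneConn D g c l).along
    (coneField l (chartField p.1 e') fun _ ↦ a') (coneField l (chartField p.1 e) fun _ ↦ a) p = 0
  rw [along_coneField hl mdifferentiableAt_const, along_coneField hl mdifferentiableAt_const,
    sub_eq_zero]
  apply cone_ext
  · simp only [hor_coneField, Pi.add_apply, Pi.smul_apply', Conn.along, h0']
    abel
  · simp only [ver_coneField, lieDer, mvfderiv_const, zero_apply, Metric.ap,
      g.symm p.1 (chartField p.1 e p.1)]
    ring

end ConeTorsion

/-! ### Smoothness of the metric pairing and of ∇. -/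

section Smoothness

open Bundle Filter VectorField

variable {E : Type*} [NormedAddCommGroup E] [NormedSpace ℝ E] [FiniteDimensional ℝ E]

lemma Metric.contMDiffAt_inner {H : Type*} [TopologicalSpace H] {I : ModelWithCorners ℝ E H}
    {M : Type*} [TopologicalSpace M] [ChartedSpace H M] [IsManifold I ∞ M] (g : Metric I M)
    {E' : Type*} [NormedAddCommGroup E'] [NormedSpace ℝ E'] {H' : Type*} [TopologicalSpace H']
    {J : ModelWithCorners ℝ E' H'} {N : Type*} [TopologicalSpace N] [ChartedSpace H' N]
    {b : N → M} {v w : ∀ y, TangentSpace I (b y)} {x : N}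
    (hv : ContMDiffAt J I.tangent ∞ (fun y ↦ (⟨b y, v y⟩ : TangentBundle I M)) x)
    (hw : ContMDiffAt J I.tangent ∞ (fun y ↦ (⟨b y, w y⟩ : TangentBundle I M)) x) :
    ContMDiffAt J 𝓘(ℝ, ℝ) ∞ (fun y ↦ g.inner (b y) (v y) (w y)) x := by
  have hb : ContMDiffAt J I ∞ b x := (contMDiffAt_totalSpace.1 hv).1
  have : ContMDiffAt J (I.prod 𝓘(ℝ, ℝ)) ∞ (fun y ↦ TotalSpace.mk' ℝ (E := Bundle.Trivial M ℝ)
      (b y) (g.inner (b y) (v y) (w y))) x :=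
    ContMDiffAt.clm_bundle_apply₂ (F₁ := E) (F₂ := E)
      (ContMDiffAt.comp x g.contMDiff.contMDiffAt hb) hv hw
  exact (contMDiffAt_totalSpace.1 this).2

lemma SmoothFunNear.metric_ap {H : Type*} [TopologicalSpace H] {I : ModelWithCorners ℝ E H}
    {M : Type*} [TopologicalSpace M] [ChartedSpace H M] [IsManifold I ∞ M] (g : Metric I M)
    {X Y : VField I M} {x : M} (hX : SmoothNear X x) (hY : SmoothNear Y x) :
    SmoothFunNear I (g.ap X Y) x := by
  filter_upwards [hX, hY] with y h h' using g.contMDiffAt_inner h h'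

variable {M : Type*} [TopologicalSpace M] [ChartedSpace E M] [IsManifold 𝓘(ℝ, E) ∞ M]
  {D : Conn 𝓘(ℝ, E) M} {g : Metric 𝓘(ℝ, E) M} {c l : ℝ} {p : M × PosReal}
  {W Z : VField (coneModel E) (M × PosReal)}

lemma radial_eq_coneField (l : ℝ) : radial (E := E) (M := M) l = coneField l 0 1 := by
  ext1 q
  apply cone_ext
  · rfl
  · simp [radial, coneField]

lemma smoothNear_radial (l : ℝ) (p : M × PosReal) : SmoothNear (radial (E := E) l) p := by
  rw [radial_eq_coneField]
  exact SmoothNear.coneField l (Eventually.of_forall fun y ↦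
    (contMDiff_zeroSection ℝ (TangentSpace 𝓘(ℝ, E) : M → _)) y) (.const 1)

lemma coneConn_coneField (hl : l ≠ 0) {Y : VField 𝓘(ℝ, E) M} {h : M → ℝ}
    (hh : MDifferentiableAt 𝓘(ℝ, E) 𝓘(ℝ, ℝ) h p.1) (w : TangentSpace (coneModel E) p) :
    coneConn D g c l (coneField l Y h) p w =
      tvec p (D Y p.1 (hor p w) + h p.1 • hor p w + (ver p w / (l * p.2)) • Y p.1)
        ((mvfderiv 𝓘(ℝ, E) h p.1 (hor p w) + ver p w / (l * p.2) * h p.1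
          - c * g.inner p.1 (hor p w) (Y p.1)) * (l * p.2)) := by
  have hX : (FiberBundle.extend E (hor p w) : VField 𝓘(ℝ, E) M) p.1 = hor p w :=
    FiberBundle.extend_apply_self E _
  have h1 := along_coneField (D := D) (g := g) (c := c) (Y := Y) hl hh
    (X := FiberBundle.extend E (hor p w)) (f := fun _ ↦ ver p w / (l * p.2))
  rw [Conn.along, coneField_eq_self hl p w hX] at h1
  rw [h1]
  apply cone_ext
  · simp only [hor_coneField, hor_tvec, Pi.add_apply, Pi.smul_apply', Conn.along, hX]
  · simp only [ver_coneField, ver_tvec, lieDer, Metric.ap, hX]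

lemma coneConn_radial (hl : l ≠ 0) (w : TangentSpace (coneModel E) p) :
    coneConn D g c l (radial l) p w = w := by
  have hs := posReal_ne_zero p.2
  have hh : MDifferentiableAt 𝓘(ℝ, E) 𝓘(ℝ, ℝ) (1 : M → ℝ) p.1 := mdifferentiableAt_const
  rw [radial_eq_coneField, coneConn_coneField hl hh]
  have h0 : mvfderiv 𝓘(ℝ, E) (1 : M → ℝ) p.1 = 0 := mvfderiv_const (1 : ℝ)
  apply cone_ext
  · simp
  · rw [ver_tvec, h0]
    simp
    field_simp

lemma smoothFunNear_inv_snd (hl : l ≠ 0) :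
    SmoothFunNear (coneModel E) (fun q : M × PosReal ↦ (l * (q.2 : ℝ))⁻¹) p := by
  refine Eventually.of_forall fun q ↦ ?_
  have h0 : l * (q.2 : ℝ) ≠ 0 := mul_ne_zero hl (posReal_ne_zero q.2)
  exact ((contDiffAt_inv ℝ h0).contMDiffAt).comp q
    (contMDiffAt_const.mul (contMDiffAt_snd_coe (E := E)))

lemma SmoothNear.ver (hZ : SmoothNear Z p) :
    SmoothFunNear (coneModel E) (fun q ↦ StatGeom.ver q (Z q)) p :=
  hZ.mono fun _ h ↦ ((contMDiffAt_cone_tangent le_rfl).1 h).2.2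

lemma SmoothFunNear.mul {H : Type*} [TopologicalSpace H] {I : ModelWithCorners ℝ E H}
    {M : Type*} [TopologicalSpace M] [ChartedSpace H M] {f h : M → ℝ} {x : M}
    (hf : SmoothFunNear I f x) (hh : SmoothFunNear I h x) :
    SmoothFunNear I (fun y ↦ f y * h y) x := by
  filter_upwards [hf, hh] with y h h' using h.mul h'

variable [T2Space M]

/-- For a lifted field Y and arbitrary W, ∇_W Y is the lift of D_{hor W} Y, plus (ver W / (λs)) Y,
minus c g(hor W, Y) ρ; each term is visibly smooth. -/
lemma SmoothNear.along_coneField_zero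
    (hD : CovariantDerivative.ContMDiffCovariantDerivative D ∞) (hl : l ≠ 0)
    {Y : VField 𝓘(ℝ, E) M} (hY : SmoothNear Y p.1) (hW : SmoothNear W p) :
    SmoothNear ((coneConn D g c l).along W (StatGeom.coneField l Y 0)) p := by
  have hY' : SmoothNear (StatGeom.coneField l Y 0) p := hY.coneField l (.const 0)
  have e : (coneConn D g c l).along W (StatGeom.coneField l Y 0) =
      (fun q ↦ inH q (D Y q.1 (hor q (W q))))
        + (fun q ↦ StatGeom.ver q (W q) * (l * (q.2 : ℝ))⁻¹) • StatGeom.coneField l Y 0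
        + (fun q ↦ -c * g.inner q.1 (hor q (W q)) (Y q.1)) • radial l := by
    ext1 q
    have h0 : mvfderiv 𝓘(ℝ, E) (0 : M → ℝ) q.1 = 0 := mvfderiv_const (0 : ℝ)
    have hh : MDifferentiableAt 𝓘(ℝ, E) 𝓘(ℝ, ℝ) (0 : M → ℝ) q.1 := mdifferentiableAt_const
    rw [Conn.along, coneConn_coneField hl hh, h0]
    apply cone_ext
    · simp [hor_coneField, radial, div_eq_mul_inv]
    · simp [ver_coneField, radial]
  have h1 : ∀ᶠ q : M × PosReal in 𝓝 p, _ :=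
    continuousAt_fst.eventually (D.eventually_contMDiffAt hD hY)
  have h2 : ∀ᶠ q : M × PosReal in 𝓝 p, _ := continuousAt_fst.eventually hY
  rw [e]
  refine (SmoothNear.add ?_ (hY'.smul (hW.ver.mul (smoothFunNear_inv_snd hl)))).add
    ((smoothNear_radial l p).smul ?_)
  · filter_upwards [hW, h1] with q h h'
    refine (contMDiffAt_cone_tangent le_rfl).2 ⟨?_, contMDiffAt_snd, contMDiffAt_const⟩
    exact ContMDiffAt.clm_bundle_apply (F₁ := E) (F₂ := E)
      (ContMDiffAt.comp q h' contMDiffAt_fst) ((contMDiffAt_cone_tangent le_rfl).1 h).1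
  · refine (SmoothFunNear.const (-c)).mul ?_
    filter_upwards [hW, h2] with q h h'
    exact g.contMDiffAt_inner ((contMDiffAt_cone_tangent le_rfl).1 h).1 (h'.comp q contMDiffAt_fst)

/-- The lifts of a local frame of M together with ρ form a local frame of the cone. -/
lemma exists_smoothNear_decomposition (hl : l ≠ 0) (hZ : SmoothNear Z p) :
    ∃ (n : ℕ) (Y : Fin n → VField 𝓘(ℝ, E) M) (f : Fin n → M × PosReal → ℝ) (h : M × PosReal → ℝ),
      (∀ i, SmoothNear (Y i) p.1) ∧ (∀ i, SmoothFunNear (coneModel E) (f i) p) ∧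
      SmoothFunNear (coneModel E) h p ∧
      ∀ᶠ q in 𝓝 p, Z q = ∑ i, f i q • coneField l (Y i) 0 q + h q • radial l q := by
  let t := trivializationAt E (TangentSpace 𝓘(ℝ, E) : M → Type _) p.1
  have hx : p.1 ∈ t.baseSet := FiberBundle.mem_baseSet_trivializationAt' p.1
  have hx' : ∀ᶠ q : M × PosReal in 𝓝 p, q.1 ∈ t.baseSet :=
    continuousAt_fst.eventually (t.open_baseSet.mem_nhds hx)
  let b := Module.finBasis ℝ E
  refine ⟨_, t.localFrame b, fun i q ↦ t.localFrameCoeff 𝓘(ℝ, E) b i q.1 (hor q (Z q)),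
    fun q ↦ ver q (Z q) * (l * (q.2 : ℝ))⁻¹, fun i ↦ ?_, fun i ↦ ?_,
    hZ.ver.mul (smoothFunNear_inv_snd hl), ?_⟩
  · filter_upwards [t.open_baseSet.mem_nhds hx] with y hy using
      contMDiffAt_localFrame_of_mem ∞ _ b i hy
  · filter_upwards [hZ, eventually_eventually_nhds.2 hx'] with q hq hq'
    have h1 := ((contMDiffAt_cone_tangent le_rfl).1 hq).1
    have h2 := ((t.contMDiffAt_iff (IB := 𝓘(ℝ, E)) (t.mem_source.2 hq'.self_of_nhds)).1 h1).2
    have h3 : ContMDiffAt (coneModel E) 𝓘(ℝ, ℝ) ∞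
        (fun y ↦ LinearMap.toContinuousLinearMap (b.coord i) (t ⟨y.1, hor y (Z y)⟩).2) q :=
      (ContinuousLinearMap.contMDiff _).contMDiffAt.comp q h2
    refine h3.congr_of_eventuallyEq (hq'.mono fun y hy ↦ ?_)
    let s : VField 𝓘(ℝ, E) M := FiberBundle.extend E (hor y (Z y))
    have hs : s y.1 = hor y (Z y) := FiberBundle.extend_apply_self E _
    have := t.localFrameCoeff_eq_coeff (I := 𝓘(ℝ, E)) (b := b) (s := s) (i := i) hy
    refine (congrArg _ hs).symm.trans (this.trans ?_)
    exact congrArg (fun v ↦ b.repr (t ⟨y.1, v⟩).2 i) hs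
  · filter_upwards [hx'] with q hq
    have hs := posReal_ne_zero q.2
    apply cone_ext
    · have := t.eq_sum_localFrameCoeff_smul (I := 𝓘(ℝ, E)) (b := b)
        (s := FiberBundle.extend E (hor q (Z q))) hq
      rw [FiberBundle.extend_apply_self] at this
      simp only [map_add, map_sum, map_smul, hor_coneField, radial,
        hor_tvec, smul_zero, add_zero]
      exact this
    · simp only [map_add, map_sum, map_smul, ver_coneField, radial, ver_tvec, Pi.zero_apply,
        zero_mul, smul_eq_mul]
      simp only [mul_zero, Finset.sum_const_zero, zero_add]
      field_simp

section AlongSmooth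

variable {E' : Type*} [NormedAddCommGroup E'] [NormedSpace ℝ E']
  {H : Type*} [TopologicalSpace H] {I : ModelWithCorners ℝ E' H}
  {N : Type*} [TopologicalSpace N] [ChartedSpace H N] [IsManifold I ∞ N]
  {C : Conn I N} {X Y Y' : VField I N} {x : N} [FiniteDimensional ℝ E'] [T2Space N]

lemma SmoothNear.along_add (hY : SmoothNear Y x) (hY' : SmoothNear Y' x)
    (h : SmoothNear (C.along X Y) x) (h' : SmoothNear (C.along X Y') x) :
    SmoothNear (C.along X (Y + Y')) x := by
  refine (h.add h').congr ?_
  filter_upwards [hY.eventually, hY'.eventually] with q h1 h2 using C.along_add_right X h1 h2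

lemma SmoothNear.along_smul {f : N → ℝ} (hX : SmoothNear X x) (hf : SmoothFunNear I f x)
    (hY : SmoothNear Y x) (h : SmoothNear (C.along X Y) x) :
    SmoothNear (C.along X (f • Y)) x := by
  refine ((h.smul hf).add (hY.smul (hf.lieDer hX))).congr ?_
  filter_upwards [hf.eventually, hY.eventually] with q h1 h2 using C.along_smul_right X h1 h2

lemma SmoothNear.along_sum {ι : Type*} (s : Finset ι) {Z : ι → VField I N}
    (hZ : ∀ i ∈ s, SmoothNear (Z i) x) (h : ∀ i ∈ s, SmoothNear (C.along X (Z i)) x) :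
    SmoothNear (C.along X (fun y ↦ ∑ i ∈ s, Z i y)) x := by
  classical
  induction s using Finset.induction_on with
  | empty =>
    refine SmoothNear.congr (X := 0) (Eventually.of_forall fun y ↦
      (contMDiff_zeroSection ℝ (TangentSpace I : N → _)) y) (.of_forall fun y ↦ ?_)
    simp only [Finset.sum_empty]
    exact DFunLike.congr_fun (C.isCovariantDerivativeOnUniv.zero (Set.mem_univ y)) (X y)
  | insert a s ha ih =>
    simp only [Finset.mem_insert, forall_eq_or_imp] at hZ h
    simp only [Finset.sum_insert ha]
    exact hZ.1.along_add (.sum hZ.2) h.1 (ih hZ.2 h.2)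

end AlongSmooth

/-- By the Leibniz rule it suffices to treat lifted fields and ρ, and ∇_W ρ = W. -/
lemma SmoothNear.along_coneConn
    (hD : CovariantDerivative.ContMDiffCovariantDerivative D ∞) (hl : l ≠ 0)
    (hW : SmoothNear W p) (hZ : SmoothNear Z p) :
    SmoothNear ((coneConn D g c l).along W Z) p := by
  obtain ⟨n, Y, f, h, hY, hf, hh, he⟩ := exists_smoothNear_decomposition hl hZ
  have hY' (i) : SmoothNear (StatGeom.coneField l (Y i) 0) p := (hY i).coneField l (.const 0)
  have hr := smoothNear_radial (E := E) l p
  let S : VField (coneModel E) (M × PosReal) :=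
    fun q ↦ ∑ i, (f i • StatGeom.coneField l (Y i) 0) q
  have h1 : SmoothNear S p := SmoothNear.sum fun i _ ↦ (hY' i).smul (hf i)
  have h2 : SmoothNear ((coneConn D g c l).along W S) p :=
    SmoothNear.along_sum _ (fun i _ ↦ (hY' i).smul (hf i)) fun i _ ↦
      hW.along_smul (hf i) (hY' i) ((hY i).along_coneField_zero hD hl hW)
  have h3 : SmoothNear ((coneConn D g c l).along W (radial l)) p :=
    hW.congr (.of_forall fun q ↦ coneConn_radial hl (W q))
  have h4 : SmoothNear ((coneConn D g c l).along W (S + h • radial l)) p :=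
    h1.along_add (hr.smul hh) h2 (hW.along_smul hh hr h3)
  refine h4.congr ?_
  have h5 : SmoothNear (S + h • radial l) p := h1.add (hr.smul hh)
  filter_upwards [eventually_eventually_nhds.2 he, h5.eventually] with q hq hq'
  exact Conn.along_congr _ W hq' hq

lemma isTorsionFreeConn_coneConn (hD : IsTorsionFreeConn D) (hl : l ≠ 0) :
    IsTorsionFreeConn (coneConn D g c l) where
  -- Smoothness of the endomorphism-valued section ∇Z is tested by evaluating it on fields W.
  smooth := ⟨⟨fun {Z} hZ p _ ↦ ContMDiffAt.contMDiffWithinAt <|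
    contMDiffAt_hom_of_forall_apply fun W hW ↦
      (hW.along_coneConn (Z := Z) hD.smooth hl (.of_forall fun q ↦ by
        simpa using hZ.contMDiffAt Filter.univ_mem)).contMDiffAt⟩⟩
  torsion_free := coneConn_torsion hD hl

end Smoothness

/-! ### Flatness and radiance of ∇. -/

section Flatness

open Bundle Filter VectorField

variable {E : Type*} [NormedAddCommGroup E] [NormedSpace ℝ E] [FiniteDimensional ℝ E]
  {M : Type*} [TopologicalSpace M] [ChartedSpace E M] [IsManifold 𝓘(ℝ, E) ∞ M]
  {D : Conn 𝓘(ℝ, E) M} {g : Metric 𝓘(ℝ, E) M} {c l : ℝ} {p : M × PosReal}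
  {X Y Z : VField 𝓘(ℝ, E) M} {a b k : ℝ}

lemma along_coneField_const (hl : l ≠ 0) :
    (coneConn D g c l).along (coneField l X fun _ ↦ a) (coneField l Y fun _ ↦ b) =
      coneField l (D.along X Y + b • X + a • Y) (fun m ↦ a * b - c * g.ap X Y m) := by
  ext1 q
  have hh : MDifferentiableAt 𝓘(ℝ, E) 𝓘(ℝ, ℝ) (fun _ : M ↦ b) q.1 := mdifferentiableAt_const
  have h0 : mvfderiv 𝓘(ℝ, E) (fun _ : M ↦ b) q.1 = 0 := mvfderiv_const b
  rw [along_coneField hl hh]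
  apply cone_ext
  · rfl
  · simp [ver_coneField, lieDer, h0]

/-- The bracket is read off from a torsion-free connection as ∇_U V - ∇_V U. The cone connection
with c = 0 is merely a convenient choice; the terms in g would cancel for any c. -/
lemma mlieBracket_coneField_const (g : Metric 𝓘(ℝ, E) M) (hD : IsTorsionFreeConn D) (hl : l ≠ 0)
    (hX : SmoothNear X p.1) (hY : SmoothNear Y p.1) :
    mlieBracket (coneModel E) (coneField l X fun _ ↦ a) (coneField l Y fun _ ↦ b) p =
      coneField l (mlieBracket 𝓘(ℝ, E) X Y) (fun _ ↦ 0) p := by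
  have hU := hX.coneField l (.const a)
  have hV := hY.coneField l (.const b)
  have h1 : (coneConn D g 0 l).along (coneField l X fun _ ↦ a) (coneField l Y fun _ ↦ b) p -
      (coneConn D g 0 l).along (coneField l Y fun _ ↦ b) (coneField l X fun _ ↦ a) p =
      mlieBracket (coneModel E) (coneField l X fun _ ↦ a) (coneField l Y fun _ ↦ b) p := by
    have : CompleteSpace (E × ℝ) := FiniteDimensional.complete ℝ (E × ℝ)
    exact (CovariantDerivative.torsion_eq_zero_iff _).1 (coneConn_torsion hD hl)
      hU.mdifferentiableAt hV.mdifferentiableAt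
  have h2 := torsion_apply_eq_zero hD hX.mdifferentiableAt hY.mdifferentiableAt
  rw [← h1, along_coneField_const hl, along_coneField_const hl]
  apply cone_ext
  · rw [map_sub, hor_coneField, hor_coneField, hor_coneField, ← h2]
    simp only [Pi.add_apply, Pi.smul_apply, Conn.along]
    abel
  · simp only [map_sub, ver_coneField, Metric.ap, g.symm p.1 (X p.1)]
    ring

/-- The inner derivative has the non-constant ρ-coefficient bk - c g(Y,Z), whose derivative along X
supplies the term X(g(Y,Z)) of (D_X g)(Y,Z). -/
lemma along_along_coneField [T2Space M] (hD : IsTorsionFreeConn D) (hl : l ≠ 0)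
    (hY : SmoothNear Y p.1) (hZ : SmoothNear Z p.1) :
    (coneConn D g c l).along (coneField l X fun _ ↦ a)
        ((coneConn D g c l).along (coneField l Y fun _ ↦ b) (coneField l Z fun _ ↦ k)) p =
      tvec p (D.along X (D.along Y Z) p.1 + k • D.along X Y p.1 + b • D.along X Z p.1
          + (b * k - c * g.ap Y Z p.1) • X p.1
          + a • (D.along Y Z p.1 + k • Y p.1 + b • Z p.1))
        ((-c * lieDer X (g.ap Y Z) p.1 + a * (b * k - c * g.ap Y Z p.1)
          - c * (g.ap X (D.along Y Z) p.1 + k * g.ap X Y p.1 + b * g.ap X Z p.1)) * (l * p.2)) := by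
  have hYZ := hY.along hD.smooth hZ
  have hg := (SmoothFunNear.metric_ap g hY hZ).mdifferentiableAt
  let δ : TangentSpace 𝓘(ℝ, E) p.1 →L[ℝ] ℝ :=
    0 - c • mvfderiv 𝓘(ℝ, E) (g.ap Y Z) p.1
  have hh : HasMFDerivAt 𝓘(ℝ, E) 𝓘(ℝ, ℝ) (fun m ↦ b * k - c * g.ap Y Z m) p.1 δ := by
    have h1 : MDifferentiableAt 𝓘(ℝ, E) 𝓘(ℝ, ℝ) (fun _ : M ↦ b * k) p.1 := mdifferentiableAt_const
    have h2 := (hasMFDerivAt_const (I := 𝓘(ℝ, E)) (I' := 𝓘(ℝ, ℝ)) (b * k) p.1).sub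
      (hg.hasMFDerivAt.const_smul c)
    exact h2
  have hk (r : ℝ) {W : VField 𝓘(ℝ, E) M} (hW : SmoothNear W p.1) :
      SmoothNear (r • W) p.1 ∧ D.along X (r • W) p.1 = r • D.along X W p.1 := by
    have h0 : mvfderiv 𝓘(ℝ, E) (fun _ : M ↦ r) p.1 = 0 := mvfderiv_const r
    refine ⟨hW.const_smul r, ?_⟩
    have := D.along_smul_right X (SmoothFunNear.const r) hW
    rw [lieDer, h0, zero_apply, zero_smul, add_zero] at this
    exact this
  rw [along_coneField_const hl, along_coneField hl hh.mdifferentiableAt]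
  apply cone_ext
  · rw [hor_coneField, hor_tvec, Pi.add_apply, Pi.add_apply,
      D.along_add_right _ (hYZ.add (hk k hY).1) (hk b hZ).1,
      D.along_add_right _ hYZ (hk k hY).1, (hk k hY).2, (hk b hZ).2]
    rfl
  · have h3 : lieDer X (fun m ↦ b * k - c * g.ap Y Z m) p.1 = -c * lieDer X (g.ap Y Z) p.1 := by
      have := DFunLike.congr_fun hh.mfderiv (X p.1)
      refine this.trans ?_
      change 0 - c * lieDer X (g.ap Y Z) p.1 = _
      ring
    rw [ver_coneField, ver_tvec, h3]
    simp only [Metric.ap, Pi.add_apply, Pi.smul_apply, map_add, map_smul, smul_eq_mul]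

/-- Once tested on fields X + aρ with a constant, the terms in a, b, k cancel by vanishing torsion
of D. The horizontal remainder is the constant curvature equation and the vertical one the symmetry
of Dg in its first two arguments. -/
lemma coneConn_flat [T2Space M] (hD : IsStatistical D g) (hc : HasConstCurv D g c) (hl : l ≠ 0)
    {U V W : VField (coneModel E) (M × PosReal)}
    (hU : SmoothNear U p) (hV : SmoothNear V p) (hW : SmoothNear W p) :
    (coneConn D g c l).curv U V W p = 0 := by
  have hT := hD.toIsTorsionFreeConn
  have key (w : TangentSpace (coneModel E) p) : ∃ (X : VField 𝓘(ℝ, E) M) (a : ℝ),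
      SmoothNear X p.1 ∧ coneField l X (fun _ ↦ a) p = w :=
    ⟨FiberBundle.extend E (hor p w), _, smoothNear_extend _,
      coneField_eq_self hl p w (FiberBundle.extend_apply_self E _)⟩
  obtain ⟨X, a, hX, eX⟩ := key (U p)
  obtain ⟨Y, b, hY, eY⟩ := key (V p)
  obtain ⟨Z, k, hZ, eZ⟩ := key (W p)
  rw [Conn.curv_congr (isTorsionFreeConn_coneConn hT hl).smooth hU hV hW
    (hX.coneField l (.const a)) (hY.coneField l (.const b)) (hZ.coneField l (.const k))
    eX.symm eY.symm eZ.symm]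
  have hb : (coneConn D g c l).along (mlieBracket (coneModel E) (coneField l X fun _ ↦ a)
      (coneField l Y fun _ ↦ b)) (coneField l Z fun _ ↦ k) p =
      coneField l (D.along (mlieBracket 𝓘(ℝ, E) X Y) Z + k • mlieBracket 𝓘(ℝ, E) X Y)
        (fun m ↦ - c * g.ap (mlieBracket 𝓘(ℝ, E) X Y) Z m) p := by
    rw [Conn.along, mlieBracket_coneField_const g hT hl hX hY]
    refine (congrFun (along_coneField_const hl) p).trans ?_
    simp
  have h2 := torsion_apply_eq_zero hT hX.mdifferentiableAt hY.mdifferentiableAt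
  have hR := hc p.1 X Y Z hX hY hZ
  have hS := hD.symm_left p.1 X Y Z hX hY hZ
  rw [Conn.curv, hb, along_along_coneField hT hl hY hZ, along_along_coneField hT hl hX hZ]
  apply cone_ext
  · simp only [map_sub, hor_tvec, hor_coneField, Pi.add_apply, Pi.smul_apply, map_zero]
    rw [Conn.curv, sub_eq_iff_eq_add, sub_eq_iff_eq_add] at hR
    rw [hR, ← h2]
    simp only [Conn.along]
    module
  · simp only [map_sub, ver_tvec, ver_coneField, map_zero]
    simp only [Conn.derMetric] at hS
    have h3 : g.ap (mlieBracket 𝓘(ℝ, E) X Y) Z p.1 =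
        g.ap (D.along X Y) Z p.1 - g.ap (D.along Y X) Z p.1 := by
      simp only [Metric.ap, ← h2, map_sub, sub_apply, Conn.along]
    have h4 : g.ap Y X p.1 = g.ap X Y p.1 := g.symm ..
    rw [h3, h4]
    -- The factor λs converts a ρ-coefficient into a ∂/∂s-component.
    linear_combination (-c * (l * p.2)) * hS

lemma isFlatAffine_coneConn [T2Space M] (hD : IsStatistical D g) (hc : HasConstCurv D g c)
    (hl : l ≠ 0) : IsFlatAffine (coneConn D g c l) where
  toIsTorsionFreeConn := isTorsionFreeConn_coneConn hD.toIsTorsionFreeConn hl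
  flat _ _ _ _ hU hV hW := coneConn_flat hD hc hl hU hV hW

lemma isRadiant_coneConn [T2Space M] (hD : IsStatistical D g) (hc : HasConstCurv D g c)
    (hl : l ≠ 0) : IsRadiant (coneConn D g c l) (radial l) where
  toIsFlatAffine := isFlatAffine_coneConn hD hc hl
  smooth_field p := (smoothNear_radial l p).contMDiffAt
  der_eq_id _ w := coneConn_radial hl w

end Flatness

/-! ### The cone metric. -/

section ConeMetric

open Bundle Filter Bornology

/-- The unit ball of kB is the unit ball of B scaled by 1/√k. -/
lemma isVonNBounded_smul_lt_one {V : Type*} [AddCommGroup V] [Module ℝ V] [TopologicalSpace V]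
    [IsTopologicalAddGroup V] [ContinuousSMul ℝ V] {B : V →L[ℝ] V →L[ℝ] ℝ}
    (hB : IsVonNBounded ℝ {v | B v v < 1}) {k : ℝ} (hk : 0 < k) :
    IsVonNBounded ℝ {v | k * B v v < 1} := by
  have h : IsVonNBounded ℝ (((√k)⁻¹ • ContinuousLinearMap.id ℝ V) '' {v | B v v < 1}) :=
    hB.image _
  refine h.subset fun v hv ↦ ?_
  refine ⟨√k • v, ?_, ?_⟩
  · have : √k * (√k * B v v) = k * B v v := by rw [← mul_assoc, Real.mul_self_sqrt hk.le]
    simpa [this] using hv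
  · simp [smul_smul, (Real.sqrt_pos.2 hk).ne']

/-- The metric `k g`. -/
def Metric.scale {E : Type*} [NormedAddCommGroup E] [NormedSpace ℝ E]
    {H : Type*} [TopologicalSpace H] {I : ModelWithCorners ℝ E H}
    {M : Type*} [TopologicalSpace M] [ChartedSpace H M] [IsManifold I ∞ M] (g : Metric I M)
    (k : ℝ) (hk : 0 < k) : Metric I M where
  inner m := k • g.inner m
  symm m v w := by simp [g.symm m v w]
  pos m v hv := by simpa using mul_pos hk (g.pos m v hv)
  isVonNBounded m := isVonNBounded_smul_lt_one (g.isVonNBounded m) hk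
  contMDiff m := (contMDiffAt_const (c := k)).smul_section (g.contMDiff m)

variable {E : Type*} [NormedAddCommGroup E] [NormedSpace ℝ E] [FiniteDimensional ℝ E]
  {M : Type*} [TopologicalSpace M] [ChartedSpace E M] [IsManifold 𝓘(ℝ, E) ∞ M]

/-- The bilinear form `s² g + ds²`. -/
def coneForm (g : Metric 𝓘(ℝ, E) M) (p : M × PosReal) :
    TangentSpace (coneModel E) p →L[ℝ] TangentSpace (coneModel E) p →L[ℝ] ℝ :=
  (p.2 : ℝ) ^ 2 • (ContinuousLinearMap.precomp ℝ (hor p) ∘L g.inner p.1 ∘L hor p)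
    + (ver p).smulRight (ver p)

@[simp] lemma coneForm_apply (g : Metric 𝓘(ℝ, E) M) (p : M × PosReal)
    (v w : TangentSpace (coneModel E) p) :
    coneForm g p v w = (p.2 : ℝ) ^ 2 * g.inner p.1 (hor p v) (hor p w) + ver p v * ver p w := by
  simp [coneForm]

/-- Both summands of the form are nonnegative, so its unit ball lies in the sum of the unit balls of
s² g and ds². -/
lemma isVonNBounded_coneForm (g : Metric 𝓘(ℝ, E) M) (p : M × PosReal) :
    IsVonNBounded ℝ {v : TangentSpace (coneModel E) p | coneForm g p v v < 1} := by
  have hs : 0 < (p.2 : ℝ) ^ 2 := pow_pos (posReal_pos p.2) 2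
  have h1 := (isVonNBounded_smul_lt_one (g.isVonNBounded p.1) hs).image (inH p)
  have h2 := ((NormedSpace.isVonNBounded_iff ℝ).2
    (Metric.isBounded_ball (x := (0 : ℝ)) (r := 1))).image (inV (E := E) p)
  refine (h1.add h2).subset fun v hv ↦ ?_
  have hv' : (p.2 : ℝ) ^ 2 * g.inner p.1 (hor p v) (hor p v) + ver p v * ver p v < 1 := by
    simpa using hv
  have hg : 0 ≤ g.inner p.1 (hor p v) (hor p v) := by
    by_cases h0 : hor p v = 0
    · simp [h0]
    · exact (g.pos _ _ h0).le
  refine ⟨_, ⟨hor p v, ?_, rfl⟩, _, ⟨ver p v, ?_, rfl⟩, cone_ext (by simp) (by simp)⟩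
  · change (p.2 : ℝ) ^ 2 * g.inner p.1 (hor p v) (hor p v) < 1
    linarith [mul_self_nonneg (ver p v)]
  · rw [mem_ball_zero_iff, Real.norm_eq_abs, ← sq_lt_one_iff_abs_lt_one, sq]
    linarith [mul_nonneg hs.le hg]

/-- The metric `s² g + ds²` on `M × ℝ^{>0}`. -/
def coneMetric (g : Metric 𝓘(ℝ, E) M) : Metric (coneModel E) (M × PosReal) where
  inner := coneForm g
  symm p v w := by
    rw [coneForm_apply, coneForm_apply, g.symm p.1 (hor p v), mul_comm (ver p v)]
  pos p v hv := by
    rw [coneForm_apply]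
    have hs : 0 < (p.2 : ℝ) ^ 2 := pow_pos (posReal_pos p.2) 2
    by_cases h0 : hor p v = 0
    · have h1 : ver p v ≠ 0 := fun h ↦ hv (cone_ext (by simp [h0]) (by simp [h]))
      rw [h0, map_zero, mul_zero, zero_add]
      exact mul_self_pos.2 h1
    · exact add_pos_of_pos_of_nonneg (mul_pos hs (g.pos _ _ h0)) (mul_self_nonneg _)
  isVonNBounded := isVonNBounded_coneForm g
  contMDiff p := by
    refine contMDiffAt_hom_of_forall_apply fun σ hσ ↦ contMDiffAt_hom_of_forall_apply fun τ hτ ↦ ?_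
    refine (contMDiffAt_section p).2 ?_
    have h1 := (contMDiffAt_cone_tangent le_rfl).1 hσ.contMDiffAt
    have h2 := (contMDiffAt_cone_tangent le_rfl).1 hτ.contMDiffAt
    have h3 := (((contMDiffAt_snd_coe (E := E) (p := p) (n := ∞)).pow 2).mul
      (g.contMDiffAt_inner h1.1 h2.1)).add (h1.2.2.mul h2.2.2)
    exact h3.congr_of_eventuallyEq (.of_forall fun q ↦ coneForm_apply g q (σ q) (τ q))

lemma coneMetric_inner (g : Metric 𝓘(ℝ, E) M) (p : M × PosReal) :
    (coneMetric g).inner p = coneForm g p := rfl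

end ConeMetric

/-! ### The potential a s², its Hessian, and its level sets. -/

section Potential

open Filter

variable {E : Type*} [NormedAddCommGroup E] [NormedSpace ℝ E] [FiniteDimensional ℝ E]
  {M : Type*} [TopologicalSpace M] [ChartedSpace E M] [IsManifold 𝓘(ℝ, E) ∞ M]
  {D : Conn 𝓘(ℝ, E) M} {g : Metric 𝓘(ℝ, E) M} {c l a k : ℝ} {p : M × PosReal}
  {X Y : VField (coneModel E) (M × PosReal)}

/-- The function `a s²` on `M × ℝ^{>0}`. -/
def squarePotential (M : Type*) (a : ℝ) (q : M × PosReal) : ℝ := a * (q.2 : ℝ) ^ 2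

lemma contMDiffAt_squarePotential :
    ContMDiffAt (coneModel E) 𝓘(ℝ, ℝ) ∞ (squarePotential M a) p :=
  contMDiffAt_const.mul ((contMDiffAt_snd_coe (E := E)).pow 2)

/-- Taken with f = s it differentiates a s² once; with f = ver Y it gives the second derivative in
the Hessian. -/
lemma mvfderiv_snd_mul {f : M × PosReal → ℝ} (hf : MDifferentiableAt (coneModel E) 𝓘(ℝ, ℝ) f p)
    (w : TangentSpace (coneModel E) p) (a : ℝ) :
    mvfderiv (coneModel E) (fun q : M × PosReal ↦ a * (q.2 : ℝ) * f q) p w =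
      a * (ver p w * f p + p.2 * mvfderiv (coneModel E) f p w) := by
  have h2 : MDifferentiableAt (coneModel E) 𝓘(ℝ, ℝ) (fun q : M × PosReal ↦ (q.2 : ℝ)) p :=
    (contMDiffAt_snd_coe (n := 1)).mdifferentiableAt (by simp)
  have h3 : MDifferentiableAt (coneModel E) 𝓘(ℝ, ℝ) (fun _ : M × PosReal ↦ a) p :=
    mdifferentiableAt_const
  have h0 : mvfderiv (coneModel E) (fun _ : M × PosReal ↦ a) p = 0 := mvfderiv_const a
  have e1 := DFunLike.congr_fun (mvfderiv_mul (h3.mul h2) hf) w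
  have e2 := DFunLike.congr_fun (mvfderiv_mul h3 h2) w
  refine e1.trans ?_
  simp only [add_apply, smul_apply, smul_eq_mul, e2, h0, mvfderiv_snd_coe, Pi.mul_apply,
    zero_apply]
  ring

lemma lieDer_squarePotential (X : VField (coneModel E) (M × PosReal)) :
    lieDer X (squarePotential M a) = fun q ↦ 2 * a * q.2 * ver q (X q) := by
  ext1 q
  have h2 : MDifferentiableAt (coneModel E) 𝓘(ℝ, ℝ) (fun q : M × PosReal ↦ (q.2 : ℝ)) q :=
    (contMDiffAt_snd_coe (n := 1)).mdifferentiableAt (by simp)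
  have h := mvfderiv_snd_mul h2 (X q) a
  rw [mvfderiv_snd_coe] at h
  have e : squarePotential M a = fun q : M × PosReal ↦ a * (q.2 : ℝ) * q.2 := by
    ext1 q; simp only [squarePotential]; ring
  rw [lieDer, e, h]
  ring

/-- The s-derivative of 2as contributes one ds², and the vertical part of ∇_X Y contributes the
other 1 - λ⁻¹ and the term in g; the derivatives of ver Y cancel. -/
lemma hess_squarePotential (hl : l ≠ 0) (hY : SmoothNear Y p) :
    (coneConn D g c l).hess (squarePotential M a) X Y p =
      2 * a * ((2 - l⁻¹) * (ver p (X p) * ver p (Y p))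
        + c * l * p.2 ^ 2 * g.inner p.1 (hor p (X p)) (hor p (Y p))) := by
  have hs := posReal_ne_zero p.2
  have h1 : lieDer X (lieDer Y (squarePotential M a)) p = 2 * a * (ver p (X p) * ver p (Y p)
      + p.2 * mvfderiv (coneModel E) (fun q ↦ ver q (Y q)) p (X p)) := by
    rw [lieDer_squarePotential]
    exact mvfderiv_snd_mul hY.ver.mdifferentiableAt (X p) (2 * a)
  rw [Conn.hess, h1, lieDer_squarePotential]
  simp only [Conn.along, coneConn_apply, ver_coneConnFun]
  rw [g.symm p.1 (hor p (Y p))]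
  field_simp
  ring

lemma isHessianPotentialOn_squarePotential (hl : l ≠ 0) (hk : 0 < k)
    (h1 : 2 * a * (2 - l⁻¹) = 1) (h2 : 2 * a * (c * l) = k) :
    IsHessianPotentialOn (coneConn D g c l) (coneMetric (g.scale k hk)) Set.univ
      (squarePotential M a) where
  smooth _ _ := contMDiffAt_squarePotential.contMDiffWithinAt
  metric_eq p _ X Y _ hY := by
    have e : (g.scale k hk).inner p.1 (hor p (X p)) (hor p (Y p)) =
        k * g.inner p.1 (hor p (X p)) (hor p (Y p)) := rfl
    rw [hess_squarePotential hl hY, Metric.ap, coneMetric_inner, coneForm_apply, e]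
    linear_combination (-ver p (X p) * ver p (Y p)) * h1
      - ((p.2 : ℝ) ^ 2 * g.inner p.1 (hor p (X p)) (hor p (Y p))) * h2

/-- The Hessian cone over a statistical manifold `(M, D, g)` of constant curvature, with metric
`k s² g + ds²`. -/
def hessianConeOf [T2Space M] (hD : IsStatistical D g) (hc : HasConstCurv D g c) (hl : l ≠ 0)
    (hl' : l ≠ 1 / 2) (hk : 0 < k) (h1 : 2 * a * (2 - l⁻¹) = 1) (h2 : 2 * a * (c * l) = k) :
    HessianCone E M where
  base := g.scale k hk
  conn := coneConn D g c l
  metric := coneMetric (g.scale k hk)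
  metric_eq p v w x y := coneForm_apply _ p (tvec p v x) (tvec p w y)
  isHessian :=
    { isFlatAffine_coneConn hD hc hl with
      locally_hessian := fun _ ↦ ⟨Set.univ, isOpen_univ, Set.mem_univ _, squarePotential M a,
        isHessianPotentialOn_squarePotential hl hk h1 h2⟩ }
  l := l
  l_ne_zero := hl
  l_ne_half := hl'
  isRadiant := isRadiant_coneConn hD hc hl

lemma isLevel_hessianConeOf [T2Space M] (hD : IsStatistical D g) (hc : HasConstCurv D g c)
    (hl : l ≠ 0) (hl' : l ≠ 1 / 2) (hk : 0 < k) (h1 : 2 * a * (2 - l⁻¹) = 1)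
    (h2 : 2 * a * (c * l) = k) (s₀ : PosReal) (hs₀ : (s₀ : ℝ) ^ 2 * k = 1) :
    (hessianConeOf hD hc hl hl' hk h1 h2).IsLevel (squarePotential M a) (a * (s₀ : ℝ) ^ 2)
      s₀ D g where
  range_eq := by
    have ha : a ≠ 0 := by rintro rfl; simp at h1
    ext q
    simp only [Set.mem_range, Set.mem_preimage, Set.mem_singleton_iff, squarePotential]
    constructor
    · rintro ⟨m, rfl⟩
      rfl
    · intro h
      have h' := (pow_left_inj₀ (posReal_pos q.2).le (posReal_pos s₀).le two_ne_zero).1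
        (mul_left_cancel₀ ha h)
      exact ⟨q.1, Prod.ext rfl (Subtype.ext h'.symm)⟩
  transverse m := by
    have ha : a ≠ 0 := by rintro rfl; simp at h1
    have hs := posReal_ne_zero s₀
    rw [lieDer_squarePotential]
    change 2 * a * (s₀ : ℝ) * (l * s₀) ≠ 0
    positivity
  induced_metric m v w := by
    change coneForm (g.scale k hk) (m, s₀) _ _ = _
    rw [coneForm_apply]
    change (s₀ : ℝ) ^ 2 * (k * g.inner m v w) + 0 * 0 = _
    rw [← mul_assoc, hs₀]
    ring
  -- Both v and Z(m, s₀) are horizontal, so the horizontal part of ∇_v Z is D_v Y; what remains is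
  -- vertical, hence a multiple of ρ.
  induced_conn m Y Z hY _ h v := by
    have hs := posReal_ne_zero s₀
    have e : D (slice Z s₀) m = D Y m := D.congr hY (h.mono fun x hx ↦ by rw [slice, hx, hor_tvec])
    have h0 : Z (m, s₀) = tvec (m, s₀) (Y m) 0 := h.self_of_nhds
    refine ⟨ver (m, s₀) (coneConnFun D g c l Z (m, s₀) (tvec (m, s₀) v 0)) / (l * s₀), ?_⟩
    change coneConnFun D g c l Z (m, s₀) (tvec (m, s₀) v 0) = _ + _ • radial l (m, s₀)
    apply cone_ext
    · rw [hor_coneConnFun, h0, map_add, map_smul]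
      change D (slice Z s₀) m v + (0 : ℝ) • _ + ((l * s₀)⁻¹ * 0 : ℝ) • v =
        D Y m v + _ • (0 : TangentSpace 𝓘(ℝ, E) m)
      rw [e]
      simp
    · simp only [map_add, map_smul, ver_tvec, radial, smul_eq_mul, zero_add]
      field_simp

/-- Eliminating a gives k = cλ²/(2λ - 1), so λ must lie above 1/2 when c > 0 and below 1/2 when c <
0; the values 1 and -1 are simple choices. -/
lemma exists_cone_constants (hc : c ≠ 0) : ∃ l a k : ℝ, l ≠ 0 ∧ l ≠ 1 / 2 ∧ 0 < k ∧
    2 * a * (2 - l⁻¹) = 1 ∧ 2 * a * (c * l) = k := by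
  rcases hc.lt_or_gt with h | h
  · exact ⟨-1, 1 / 6, -c / 3, by norm_num, by norm_num, by linarith, by norm_num, by ring⟩
  · exact ⟨1, 1 / 2, c, by norm_num, by norm_num, h, by norm_num, by ring⟩

end Potential
end StatGeom

end

theorem mainTheorem2
    {E : Type*} [NormedAddCommGroup E] [NormedSpace ℝ E] [FiniteDimensional ℝ E]
    {M : Type*} [TopologicalSpace M] [T2Space M] [ChartedSpace E M] [IsManifold 𝓘(ℝ, E) ∞ M]
    (D : StatGeom.Conn 𝓘(ℝ, E) M) (g : StatGeom.Metric 𝓘(ℝ, E) M)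
    (hstat : StatGeom.IsStatistical D g)
    (c : ℝ) (hc : c ≠ 0) (hcurv : StatGeom.HasConstCurv D g c) :
    ∃ (C : StatGeom.HessianCone E M) (f : M × StatGeom.PosReal → ℝ),
      StatGeom.IsHessianPotentialOn C.conn C.metric Set.univ f ∧
      ∃ (t : ℝ) (s₀ : StatGeom.PosReal), C.IsLevel f t s₀ D g := by
  obtain ⟨l, a, k, hl, hl', hk, h1, h2⟩ := StatGeom.exists_cone_constants hc
  -- The slice s₀ = 1/√k undoes the rescaling of the base metric from g to k g.
  have hs : (√k)⁻¹ ^ 2 * k = 1 := by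
    rw [inv_pow, Real.sq_sqrt hk.le, inv_mul_cancel₀ hk.ne']
  exact ⟨StatGeom.hessianConeOf hstat hcurv hl hl' hk h1 h2, StatGeom.squarePotential M a,
    StatGeom.isHessianPotentialOn_squarePotential hl hk h1 h2, _,
    ⟨(√k)⁻¹, inv_pos.2 (Real.sqrt_pos.2 hk)⟩,
    StatGeom.isLevel_hessianConeOf hstat hcurv hl hl' hk h1 h2 _ hs⟩
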